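/- Let $\beta>1$, $\beta'=\beta/(\beta-1)$, $0<\sigma\le 1$, $\gamma>1$ and $A,B,H>0$. Then there is a constant $C=C(\beta,\sigma,\gamma,A,B,H)>0$ with the following property. Let $(M,\mu)$ and $(N,\nu)$ be $\sigma$-finite (or, more generally, s-finite) measure spaces, let $k:N\times M\to[-\infty,\infty]$ be $\nu\times\mu$-measurable, and let $$Tf(x)=\int_M k(x,y)f(y)\,d\mu(y),\qquad x\in N .$$ For $t>0$ put $$k_1^*(x,t)=\inf\{s>0:\ \mu(\{y\in M:|k(x,y)|>s\})\le t\},\qquad k_2^*(y,t)=\inf\{s>0:\ \nu(\{x\in N:|k(x,y)|>s\})\le t\},$$ $$k_1^*(t)=\operatorname*{ess\,sup}_{x\in N}k_1^*(x,t),\qquad k_2^*(t)=\operatorname*{ess\,sup}_{y\in M}k_2^*(y,t).$$ Suppose that for some $\tau>0$ $$k_1^*(t)\le A^{1/\beta}t^{-1/\beta}\big(1+H(1+|\log t|)^{-\gamma}\big)\quad(0<t\le\tau),\qquad k_2^*(t)\le B\,t^{-1/(\sigma\beta)}\quad(t>0),$$ $$J_\tau:=\frac1A\operatorname*{ess\,sup}_{x\in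 N}\int_\tau^\infty k_1^*(x,t)^\beta\,dt<\infty .$$ Then for every real-valued $f\in L^{\beta'}(M)$ the integral $Tf(x)$ is well defined and finite for $\nu$-a.e. $x\in N$, and $Tf$ is $\nu$-measurable. Moreover, for every such $f$ with $\|f\|_{\beta'}\le1$: (a) for every measurable $E\subseteq N$ with $\nu(E)<\infty$, $$\int_E\exp\Big[\frac{\sigma}{A}|Tf(x)|^\beta\Big]d\nu(x)\le C e^{\sigma J_\tau}\big(\nu(E)+\tau^\sigma(1+J_\tau)\big);$$ (b) with $m=\lceil\beta'-2\rceil$ (the smallest integer $\ge\beta'-2$) and $\exp_m(t)=e^t-\sum_{j=0}^m t^j/j!$, $$\int_N\exp_m\Big[\frac{\sigma}{A}|Tf(x)|^\beta\Big]d\nu(x)\le C e^{\sigma J_\tau}\big(\|Tf\|_{\beta'}^{\beta'}+\tau^\sigma(1+J_\tau)\big),$$ where the right-hand side is $+\infty$ if $Tf\notin L^{\beta'}(N)$. -/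

import Mathlib

open MeasureTheory Set
open scoped ENNReal

noncomputable section

namespace AdamsIneq

/-- The nonincreasing rearrangement `g^*(t) = inf {s > 0 : m {|g| > s} ≤ t}`, for `t > 0`, of a
function given through its absolute value `g : X → [0, ∞]`; the infimum is `∞` when no finite
`s` qualifies. -/
def rearrangement {X : Type*} [MeasurableSpace X] (m : Measure X) (g : X → ℝ≥0∞) (t : ℝ) : ℝ≥0∞ :=
  sInf {s : ℝ≥0∞ | 0 < s ∧ m {y | s < g y} ≤ ENNReal.ofReal t}

variable {M N : Type*} [MeasurableSpace M] [MeasurableSpace N]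

/-- The partial rearrangement `k₁^*(x, t)`: rearrange `k(x, ·)` on `(M, μ)`. -/
def partialRearr₁ (μ : Measure M) (k : N → M → EReal) (x : N) (t : ℝ) : ℝ≥0∞ :=
  rearrangement μ (fun y => (k x y).abs) t

/-- The partial rearrangement `k₂^*(y, t)`: rearrange `k(·, y)` on `(N, ν)`. -/
def partialRearr₂ (ν : Measure N) (k : N → M → EReal) (y : M) (t : ℝ) : ℝ≥0∞ :=
  rearrangement ν (fun x => (k x y).abs) t

/-- The maximal rearrangement `k₁^*(t) = ess sup_{x ∈ N} k₁^*(x, t)`. -/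
def maxRearr₁ (μ : Measure M) (ν : Measure N) (k : N → M → EReal) (t : ℝ) : ℝ≥0∞ :=
  essSup (fun x => partialRearr₁ μ k x t) ν

/-- The maximal rearrangement `k₂^*(t) = ess sup_{y ∈ M} k₂^*(y, t)`. -/
def maxRearr₂ (μ : Measure M) (ν : Measure N) (k : N → M → EReal) (t : ℝ) : ℝ≥0∞ :=
  essSup (fun y => partialRearr₂ ν k y t) μ

/-- The quantity `J_τ = A⁻¹ ess sup_{x ∈ N} ∫_τ^∞ k₁^*(x, t)^β dt ∈ [0, ∞]`. -/
def critJ (μ : Measure M) (ν : Measure N) (k : N → M → EReal) (A β τ : ℝ) : ℝ≥0∞ :=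
  (ENNReal.ofReal A)⁻¹ *
    essSup (fun x => ∫⁻ t in Ioi τ, (partialRearr₁ μ k x t) ^ β) ν

/-- The integral `∫ k(x, y) f(y) dμ(y)` is well defined and finite: the integrand, with values in
`[-∞, ∞]`, is measurable and the integral of its absolute value is finite. -/
def PotentialFinite (μ : Measure M) (k : N → M → EReal) (f : M → ℝ) (x : N) : Prop :=
  AEMeasurable (fun y => k x y * (f y : EReal)) μ ∧ ∫⁻ y, (k x y * (f y : EReal)).abs ∂μ < ∞

/-- The potential `Tf(x) = ∫ k(x, y) f(y) dμ(y)`. Wherever `PotentialFinite μ k f x` holds the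
integrand is finite almost everywhere, so that `EReal.toReal` changes it on a null set only. -/
def potential (μ : Measure M) (k : N → M → EReal) (f : M → ℝ) (x : N) : ℝ :=
  ∫ y, (k x y * (f y : EReal)).toReal ∂μ

/-- The regularized exponential `exp_m(t) = e^t - ∑_{j=0}^m t^j / j!`. -/
def regExp (m : ℕ) (t : ℝ) : ℝ :=
  Real.exp t - ∑ j ∈ Finset.range (m + 1), t ^ j / (j.factorial : ℝ)

end AdamsIneq

end

/-! Replace k and f by |k| and |f|, let S be the resulting potential and F_n the part of E where S^β
> A n. The exponential integral is at most ν(E) + Σ e^{σ(n+1)} ν(F_n). Put r_n = min(τ,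
ν(F_n)^{1/σ}) and T_n = log(τ/r_n) + J. When r_n < τ, ν(F_n) = τ^σ e^{σ(J - T_n)}, so the task is to
bound Σ e^{σ(n - T_n)} by a constant, in the manner of Adams and Garsia.

About the kernel, only `KernelBounds` is used: weak type bounds in each variable, and the bound
A(log(τ/r) + J + K) for the integral of |k|^β over {|k| ≤ c r^{-1/β}}. The leading constant A is
exact; since γ > 1, the logarithmic perturbation costs only the additive K. The part of k above a
truncation level has no pointwise bound, but a Schur type estimate
(`KernelBounds.lintegral_singular_rpow_le`) controls its average over a set that is not too small,
hence its value at some point of that set.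

Two-scale estimate (`KernelBounds.exists_two_scale_bound`): at scale r, split the density into its
largest values, carried by a weight of total mass at most r (`exists_weight`), and the rest. If the
first part carries δ^p of the p-th power mass, the rest against the truncated kernel gives the sharp
term with factor (1 - δ^p)^{1/p}, and every other contribution is O(δ (1 + log(r/r'))^{1/β}). For
levels m ≤ n this reads n^{1/β} ≤ κ δ_m (1 + T_n - T_m)^{1/β} + (1 - δ_m^p)^{1/p} (T_m + κ)^{1/β}.

Taking m = n gives n ≤ T_n + const, which alone does not make the sum converge. The point is to
count the n with T_n ≤ n + l. For such an m the estimate is nearly saturated, so δ_m^p (T_m + κ) =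
O(1 + l) (`mass_le`); with so small a mass, a later n of the same kind must satisfy T_n - T_m = O(1
+ l) (`gap_le`). Hence there are O(1 + l) such n, and Σ_l (1 + l) e^{-σ l} converges.

The whole-space inequality follows by Chebyshev on {|Tf| > 1} and, on {|Tf| ≤ 1}, from the order of
vanishing of the regularized exponential at 0. -/

namespace AdamsIneq

/-! ### Dyadic integration of functions with weak type bounds -/

section Tail

theorem exists_pow_mul_lt_le {s g : ℝ≥0∞} (hs : s ≠ 0) (hsg : s < g) (hg : g ≠ ∞) :
    ∃ j : ℕ, 2 ^ j * s < g ∧ g ≤ 2 ^ (j + 1) * s := by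
  have hs' : s ≠ ∞ := (hsg.trans_le le_top).ne
  have hex : ∃ j : ℕ, g ≤ 2 ^ j * s := by
    lift s to NNReal using hs'
    lift g to NNReal using hg
    have h0 : 0 < s := pos_iff_ne_zero.2 (by exact_mod_cast hs)
    obtain ⟨n, hn⟩ := pow_unbounded_of_one_lt (g / s) (one_lt_two : (1 : NNReal) < 2)
    refine ⟨n, ?_⟩
    rw [div_lt_iff₀ h0] at hn
    exact_mod_cast hn.le
  classical
  have hspec := Nat.find_spec hex
  have hne : Nat.find hex ≠ 0 := by
    intro h
    rw [h, pow_zero, one_mul] at hspec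
    exact absurd hsg (not_lt.2 hspec)
  obtain ⟨j, hj⟩ := Nat.exists_eq_succ_of_ne_zero hne
  refine ⟨j, ?_, ?_⟩
  · exact not_le.1 (Nat.find_min hex (by omega))
  · rwa [hj] at hspec

variable {X : Type*} [MeasurableSpace X] {m : Measure X} {g : X → ℝ≥0∞}

/-- Contribution of one dyadic shell to the integral of `g ^ a`. -/
theorem dyadic_shell_le (hg : Measurable g) {a b : ℝ} (ha : 0 ≤ a) {s Q : ℝ≥0∞} (j : ℕ)
    (h : m {y | 2 ^ j * s < g y} ≤ Q * (2 ^ (-b)) ^ j) :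
    ∫⁻ y, {y | 2 ^ j * s < g y}.indicator (fun _ => (2 ^ (j + 1) * s) ^ a) y ∂m ≤
      2 ^ a * s ^ a * Q * (2 ^ (a - b)) ^ j := by
  rw [lintegral_indicator (measurableSet_lt measurable_const hg), setLIntegral_const]
  refine (mul_le_mul_right h _).trans (le_of_eq ?_)
  have h2 : (2 : ℝ≥0∞) ^ (a - b) = 2 ^ a * 2 ^ (-b) := by
    rw [sub_eq_add_neg, ENNReal.rpow_add _ _ (by norm_num) (by norm_num)]
  rw [h2, ENNReal.mul_rpow_of_nonneg _ _ ha, mul_pow, pow_succ, ENNReal.mul_rpow_of_nonneg _ _ ha,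
    ← ENNReal.rpow_natCast 2 j, ← ENNReal.rpow_natCast (2 ^ a) j, ← ENNReal.rpow_mul,
    ← ENNReal.rpow_mul, mul_comm (j : ℝ) a]
  ring

/-- The constant in the estimate of the tail integral of a weakly integrable function. -/
noncomputable def tailConst (a b : ℝ) : ℝ≥0∞ := 2 ^ a * (1 - 2 ^ (a - b))⁻¹

theorem tailConst_ne_top {a b : ℝ} (ha : 0 ≤ a) (hab : a < b) : tailConst a b ≠ ∞ := by
  refine ENNReal.mul_ne_top (ENNReal.rpow_ne_top_of_nonneg ha (by norm_num)) ?_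
  rw [ENNReal.inv_ne_top]
  have : (2 : ℝ≥0∞) ^ (a - b) < 1 :=
    ENNReal.rpow_lt_one_of_one_lt_of_neg (by norm_num) (by linarith)
  exact (tsub_pos_of_lt this).ne'

/-- The dyadic shells contribute a geometric series of ratio 2^{a-b}. For a ≥ b the truncated
subtraction in `tailConst` makes the constant `∞`; a < b matters only for its finiteness. -/
theorem lintegral_tail_rpow_le (hg : Measurable g) {a b : ℝ} (ha : 0 ≤ a)
    {s Q : ℝ≥0∞} (hs : s ≠ 0)
    (h : ∀ j : ℕ, m {y | 2 ^ j * s < g y} ≤ Q * (2 ^ (-b)) ^ j) :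
    ∫⁻ y in {y | s < g y}, g y ^ a ∂m ≤ tailConst a b * s ^ a * Q := by
  rw [← lintegral_indicator (measurableSet_lt measurable_const hg)]
  have hpt : ∀ y, {y | s < g y}.indicator (fun y => g y ^ a) y ≤
      ∑' j : ℕ, {y | 2 ^ j * s < g y}.indicator (fun _ => (2 ^ (j + 1) * s) ^ a) y := by
    intro y
    by_cases hy : s < g y
    swap
    · simp [hy]
    rw [indicator_of_mem (show y ∈ {y | s < g y} from hy)]
    have hs' : s ≠ ∞ := (hy.trans_le le_top).ne
    by_cases hgt : g y = ∞
    -- Where g = ∞, every term of the series is at least s^a > 0, so the series diverges.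
    · have : ∀ j : ℕ, s ^ a ≤
          {y | 2 ^ j * s < g y}.indicator (fun _ => (2 ^ (j + 1) * s) ^ a) y := by
        intro j
        rw [indicator_of_mem]
        · refine ENNReal.rpow_le_rpow ?_ ha
          exact le_mul_of_one_le_left (by simp) (one_le_pow₀ (by norm_num))
        · simp only [mem_ofPred_eq, hgt]
          exact ENNReal.mul_lt_top (by simp) hs'.lt_top
      refine le_trans ?_ (ENNReal.tsum_le_tsum this)
      rw [ENNReal.tsum_const_eq_top_of_ne_zero]
      · exact le_top
      · exact (ENNReal.rpow_pos (pos_iff_ne_zero.2 hs) hs').ne'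
    · obtain ⟨j, h1, h2⟩ := exists_pow_mul_lt_le hs hy hgt
      refine le_trans ?_ (ENNReal.le_tsum j)
      rw [indicator_of_mem (show y ∈ {y | 2 ^ j * s < g y} from h1)]
      exact ENNReal.rpow_le_rpow h2 ha
  refine (lintegral_mono hpt).trans ?_
  rw [lintegral_tsum fun j => (measurable_const.indicator
    (measurableSet_lt measurable_const hg)).aemeasurable]
  refine (ENNReal.tsum_le_tsum fun j => dyadic_shell_le hg ha j (h j)).trans (le_of_eq ?_)
  rw [ENNReal.tsum_mul_left, ENNReal.tsum_geometric, tailConst]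
  ring

/-- At the critical exponent all shells have the same bound, so the number of shells appears as a
factor. This is the source of log(r/r') in the two-scale estimate. -/
theorem lintegral_middle_rpow_le (hg : Measurable g) {a : ℝ} (ha : 0 ≤ a)
    {s Q : ℝ≥0∞} (hs : s ≠ 0) (hs' : s ≠ ∞)
    (h : ∀ j : ℕ, m {y | 2 ^ j * s < g y} ≤ Q * (2 ^ (-a)) ^ j) (n : ℕ) :
    ∫⁻ y in {y | s < g y ∧ g y ≤ 2 ^ n * s}, g y ^ a ∂m ≤ n * (2 ^ a * s ^ a * Q) := by
  have hmeas : MeasurableSet {y | s < g y ∧ g y ≤ 2 ^ n * s} :=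
    (measurableSet_lt measurable_const hg).inter (measurableSet_le hg measurable_const)
  rw [← lintegral_indicator hmeas]
  have hpt : ∀ y, {y | s < g y ∧ g y ≤ 2 ^ n * s}.indicator (fun y => g y ^ a) y ≤
      ∑ j ∈ Finset.range n,
        {y | 2 ^ j * s < g y}.indicator (fun _ => (2 ^ (j + 1) * s) ^ a) y := by
    intro y
    by_cases hy : s < g y ∧ g y ≤ 2 ^ n * s
    swap
    · rw [indicator_of_notMem (show y ∉ {y | s < g y ∧ g y ≤ 2 ^ n * s} from hy)]; exact zero_le
    rw [indicator_of_mem (show y ∈ {y | s < g y ∧ g y ≤ 2 ^ n * s} from hy)]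
    have hgt : g y ≠ ∞ := (hy.2.trans_lt (ENNReal.mul_lt_top (by simp) hs'.lt_top)).ne
    obtain ⟨j, h1, h2⟩ := exists_pow_mul_lt_le hs hy.1 hgt
    have hj : j < n := by
      by_contra! hj
      refine absurd (h1.trans_le hy.2) (not_lt.2 ?_)
      exact mul_le_mul_left (pow_le_pow_right₀ (by norm_num) hj) _
    refine le_trans ?_ (Finset.single_le_sum (fun _ _ => zero_le) (Finset.mem_range.2 hj))
    rw [indicator_of_mem (show y ∈ {y | 2 ^ j * s < g y} from h1)]
    exact ENNReal.rpow_le_rpow h2 ha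
  refine (lintegral_mono hpt).trans ?_
  rw [lintegral_finsetSum _ fun j _ => measurable_const.indicator
    (measurableSet_lt measurable_const hg)]
  refine (Finset.sum_le_sum fun j _ => dyadic_shell_le hg ha j (h j)).trans (le_of_eq ?_)
  simp

end Tail

/-! ### Nonincreasing rearrangements -/

section Rearrangement

variable {X : Type*} [MeasurableSpace X] {m : Measure X} {g : X → ℝ≥0∞}

theorem rearrangement_antitone (m : Measure X) (g : X → ℝ≥0∞) :
    Antitone (rearrangement m g) := fun _ _ h =>
  sInf_le_sInf fun _ hs => ⟨hs.1, hs.2.trans (ENNReal.ofReal_le_ofReal h)⟩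

theorem rearrangement_congr {g' : X → ℝ≥0∞} (h : g =ᵐ[m] g') :
    rearrangement m g = rearrangement m g' := by
  funext t
  unfold rearrangement
  congr 1
  ext s
  have : m {y | s < g y} = m {y | s < g' y} :=
    measure_congr (h.mono fun y hy => by
      change (s < g y) = (s < g' y)
      rw [hy])
  simp [this]

theorem measure_lt_le_of_rearrangement_le {t : ℝ} {v : ℝ≥0∞} (h : rearrangement m g t ≤ v) :
    m {y | v < g y} ≤ ENNReal.ofReal t := by
  rcases eq_or_ne v ∞ with rfl | hv
  · simp
  obtain ⟨u, hu, huv, hlim⟩ := exists_seq_strictAnti_tendsto' (lt_top_iff_ne_top.2 hv)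
  have hset : {y | v < g y} = ⋃ n, {y | u n < g y} := by
    ext y
    simp only [mem_ofPred_eq, mem_iUnion]
    constructor
    · intro hy
      exact (hlim.eventually (gt_mem_nhds hy)).exists
    · rintro ⟨n, hn⟩
      exact (huv n).1.trans hn
  have hmono : Monotone fun n => {y | u n < g y} := fun i j hij y hy =>
    (hu.antitone hij).trans_lt hy
  rw [hset, hmono.measure_iUnion]
  refine iSup_le fun n => ?_
  obtain ⟨s, hs, hsu⟩ := sInf_lt_iff.1 (h.trans_lt (huv n).1)
  exact (measure_mono fun y (hy : u n < g y) => hsu.trans hy).trans hs.2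

/-- The half of equimeasurability that is needed: a t with rearrangement at most v satisfies μ{g >
v} ≤ t, so every smaller positive t lies in the superlevel set of the rearrangement. -/
theorem measure_lt_le_volume_rearrangement (v : ℝ≥0∞) :
    m {y | v < g y} ≤ volume.restrict (Ioi 0) {t : ℝ | v < rearrangement m g t} := by
  have hmeas : MeasurableSet {t : ℝ | v < rearrangement m g t} :=
    measurableSet_lt measurable_const (rearrangement_antitone m g).measurable
  rw [Measure.restrict_apply hmeas]
  set c := m {y | v < g y} with hc
  have hsub : {t : ℝ | 0 < t ∧ ENNReal.ofReal t < c} ⊆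
      {t : ℝ | v < rearrangement m g t} ∩ Ioi 0 := by
    rintro t ⟨ht, htc⟩
    refine ⟨?_, ht⟩
    by_contra hcon
    exact absurd (measure_lt_le_of_rearrangement_le (not_lt.1 hcon)) (not_le.2 htc)
  refine le_trans ?_ (measure_mono hsub)
  rcases eq_or_ne c ∞ with h | h
  · have : {t : ℝ | 0 < t ∧ ENNReal.ofReal t < c} = Ioi 0 := by
      ext t; simp [h]
    rw [this, h, Real.volume_Ioi]
  · have : {t : ℝ | 0 < t ∧ ENNReal.ofReal t < c} = Ioo 0 c.toReal := by
      ext t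
      simp only [mem_ofPred_eq, mem_Ioo]
      exact and_congr_right fun ht => by
        rw [ENNReal.ofReal_lt_iff_lt_toReal ht.le h]
    rw [this, Real.volume_Ioo, sub_zero, ENNReal.ofReal_toReal h]

theorem lintegral_min_rpow_eq {u : X → ℝ≥0∞} (hu : Measurable u) {a : ℝ} (ha : 0 < a)
    {s : ℝ≥0∞} (hs : s ≠ ∞) :
    ∫⁻ y, min (u y) s ^ a ∂m = ENNReal.ofReal a * ∫⁻ t in Ioi (0 : ℝ),
      m {y | t < (min (u y) s).toReal} * ENNReal.ofReal (t ^ (a - 1)) := by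
  rw [← lintegral_rpow_eq_lintegral_meas_lt_mul m (Filter.Eventually.of_forall fun _ =>
    ENNReal.toReal_nonneg) (hu.min measurable_const).ennreal_toReal.aemeasurable ha]
  refine lintegral_congr fun y => ?_
  have : min (u y) s ≠ ∞ := ne_top_of_le_ne_top hs (min_le_right _ _)
  rw [← ENNReal.ofReal_rpow_of_nonneg ENNReal.toReal_nonneg ha.le, ENNReal.ofReal_toReal this]

theorem setOf_lt_toReal_min {Y : Type*} (u : Y → ℝ≥0∞) {s : ℝ≥0∞} (hs : s ≠ ∞) {t : ℝ}
    (ht : 0 < t) :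
    {y | t < (min (u y) s).toReal} = {y | ENNReal.ofReal t < u y ∧ ENNReal.ofReal t < s} := by
  ext y
  have : min (u y) s ≠ ∞ := ne_top_of_le_ne_top hs (min_le_right _ _)
  simp only [mem_ofPred_eq]
  rw [← ENNReal.ofReal_lt_iff_lt_toReal ht.le this, lt_min_iff]

/-- Layer cake on both sides; the finite cap s makes the integrands real-valued, as the layer-cake
formula requires. -/
theorem lintegral_min_rpow_le_rearrangement (hg : Measurable g) {a : ℝ} (ha : 0 < a)
    {s : ℝ≥0∞} (hs : s ≠ ∞) :
    ∫⁻ y, min (g y) s ^ a ∂m ≤ ∫⁻ t in Ioi (0 : ℝ), min (rearrangement m g t) s ^ a := by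
  rw [lintegral_min_rpow_eq hg ha hs,
    lintegral_min_rpow_eq (rearrangement_antitone m g).measurable ha hs]
  refine mul_le_mul_right (setLIntegral_mono' measurableSet_Ioi fun t ht =>
    mul_le_mul_left ?_ _) _
  rw [setOf_lt_toReal_min _ hs ht, setOf_lt_toReal_min _ hs ht]
  by_cases h : ENNReal.ofReal t < s
  · simpa [h] using measure_lt_le_volume_rearrangement _
  · simp [h]

/-- An essential supremum bound that is uniform over a half-open interval of parameters holds
almost everywhere simultaneously for all parameters. -/
theorem ae_forall_le_of_essSup_le {N : Type*} [MeasurableSpace N] {ν : Measure N}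
    {R : N → ℝ → ℝ≥0∞} (hR : ∀ x, Antitone (R x)) {φ : ℝ → ℝ≥0∞} {τ : ℝ}
    (hφ : ∀ t, 0 < t → ContinuousAt φ t)
    (h : ∀ t, 0 < t → t ≤ τ → essSup (fun x => R x t) ν ≤ φ t) :
    ∀ᵐ x ∂ν, ∀ t, 0 < t → t ≤ τ → R x t ≤ φ t := by
  have h1 : ∀ᵐ x ∂ν, ∀ q : ℚ, (0 : ℝ) < q → (q : ℝ) ≤ τ → R x q ≤ φ q := by
    rw [ae_all_iff]
    intro q
    by_cases hq : (0 : ℝ) < q ∧ (q : ℝ) ≤ τ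
    · filter_upwards [ENNReal.ae_le_essSup (μ := ν) fun x => R x q] with x hx _ _
      exact hx.trans (h q hq.1 hq.2)
    · exact Filter.Eventually.of_forall fun x h0 h1 => absurd ⟨h0, h1⟩ hq
  filter_upwards [h1] with x hx t ht htτ
  -- Rationals q increasing to t: monotonicity gives R x t ≤ R x q ≤ φ q, and φ q tends to φ t. Only
  -- countably many null sets are discarded.
  obtain ⟨u, -, hu, hlim⟩ := Real.exists_seq_rat_strictMono_tendsto t
  refine ge_of_tendsto ((hφ t ht).tendsto.comp hlim) ?_
  filter_upwards [hlim.eventually (lt_mem_nhds ht)] with n hn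
  exact (hR x (hu n).le).trans (hx _ hn ((hu n).le.trans htτ))

end Rearrangement

end AdamsIneq

/-! ### Truncated kernels and their weak type bounds -/

namespace AdamsIneq

/-- `z` if `z ∈ S`, and `0` otherwise. -/
noncomputable def keep (S : Set ℝ≥0∞) (z : ℝ≥0∞) : ℝ≥0∞ := S.indicator id z

theorem measurable_keep {S : Set ℝ≥0∞} (hS : MeasurableSet S) : Measurable (keep S) :=
  measurable_id.indicator hS

theorem keep_rpow (S : Set ℝ≥0∞) (z : ℝ≥0∞) {a : ℝ} (ha : 0 < a) :
    keep S z ^ a = S.indicator (fun w => w ^ a) z := by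
  unfold keep
  by_cases h : z ∈ S <;> simp [h, ha]

theorem keep_le_self (S : Set ℝ≥0∞) (z : ℝ≥0∞) : keep S z ≤ z := indicator_le_self' (by simp) z

theorem keep_Iic_le (s z : ℝ≥0∞) : keep (Iic s) z ≤ s := by
  unfold keep
  by_cases h : z ≤ s <;> simp [h]

theorem le_keep_add_keep (s z : ℝ≥0∞) : z ≤ keep (Iic s) z + keep (Ioi s) z := by
  unfold keep
  rcases le_or_gt z s with h | h <;> simp [h, not_le.2, not_lt.2]

theorem keep_Ioi_le (s t z : ℝ≥0∞) : keep (Ioi s) z ≤ keep (Ioc s t) z + keep (Ioi t) z := by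
  unfold keep
  by_cases h : s < z
  · rcases le_or_gt z t with h' | h' <;> simp [h, h']
  · simp [h]

theorem lintegral_keep_rpow {X : Type*} [MeasurableSpace X] {m : Measure X} {g : X → ℝ≥0∞}
    (hg : Measurable g) {S : Set ℝ≥0∞} (hS : MeasurableSet S) {a : ℝ} (ha : 0 < a) :
    ∫⁻ y, keep S (g y) ^ a ∂m = ∫⁻ y in g ⁻¹' S, g y ^ a ∂m := by
  rw [← lintegral_indicator (hg hS)]
  refine lintegral_congr fun y => ?_
  rw [keep_rpow _ _ ha]
  rfl

/-- The truncation level `c r^{-1/β}`. -/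
noncomputable def cut (β c r : ℝ) : ℝ≥0∞ := ENNReal.ofReal (c * r ^ (-(1 / β)))

theorem cut_ne_zero {β c r : ℝ} (hc : 0 < c) (hr : 0 < r) : cut β c r ≠ 0 := by
  have : 0 < c * r ^ (-(1 / β)) := by positivity
  simpa [cut] using this

theorem cut_ne_top {β c r : ℝ} : cut β c r ≠ ∞ := ENNReal.ofReal_ne_top

theorem cut_rpow_mul {β c r : ℝ} (hβ : 0 < β) (hc : 0 < c) (hr : 0 < r) :
    cut β c r ^ β * ENNReal.ofReal r = ENNReal.ofReal (c ^ β) := by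
  rw [cut, ENNReal.ofReal_rpow_of_nonneg (by positivity) hβ.le,
    ← ENNReal.ofReal_mul (by positivity)]
  congr 1
  rw [Real.mul_rpow hc.le (by positivity), ← Real.rpow_mul hr.le]
  have : -(1 / β) * β = -1 := by field_simp
  rw [this, Real.rpow_neg_one]
  field_simp

theorem cut_mul_two_pow {β c r : ℝ} (hβ : 0 < β) (hr : 0 < r) (j : ℕ) :
    cut β c (r * (2 ^ (-β) : ℝ) ^ j) = 2 ^ j * cut β c r := by
  have h2 : (2 : ℝ≥0∞) ^ j = ENNReal.ofReal (2 ^ j) := by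
    rw [ENNReal.ofReal_pow (by norm_num)]; simp
  rw [cut, cut, h2, ← ENNReal.ofReal_mul (by positivity)]
  congr 1
  rw [Real.mul_rpow hr.le (by positivity), ← Real.rpow_natCast (2 ^ (-β)) j,
    ← Real.rpow_mul zero_le_two, ← Real.rpow_mul zero_le_two]
  have : -β * j * -(1 / β) = j := by field_simp
  rw [this, Real.rpow_natCast]
  ring

theorem ofReal_mul_two_rpow_pow {β r : ℝ} (hr : 0 < r) (j : ℕ) :
    ENNReal.ofReal (r * (2 ^ (-β) : ℝ) ^ j) = ENNReal.ofReal r * (2 ^ (-β)) ^ j := by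
  rw [ENNReal.ofReal_mul hr.le, ENNReal.ofReal_pow (by positivity),
    ← ENNReal.ofReal_rpow_of_pos (by norm_num)]
  simp

/-- The quantitative properties of a nonnegative kernel used in the proof of the Adams
inequality: weak type bounds in both variables and a sharp bound of the truncated `L^β` norm. -/
structure KernelBounds {M N : Type*} [MeasurableSpace M] [MeasurableSpace N] (μ : Measure M)
    (ν : Measure N) (G : N → M → ℝ≥0∞) (β σ A B c K J τ : ℝ) : Prop where
  measurable : Measurable (Function.uncurry G)
  tail_le : ∀ᵐ x ∂ν, ∀ r, 0 < r → r ≤ τ → μ {y | cut β c r < G x y} ≤ ENNReal.ofReal r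
  trunc_le : ∀ᵐ x ∂ν, ∀ r, 0 < r → r ≤ τ →
    ∫⁻ y, keep (Iic (cut β c r)) (G x y) ^ β ∂μ ≤
      ENNReal.ofReal (A * (Real.log (τ / r) + J + K))
  dual_tail_le : ∀ᵐ y ∂μ, ∀ v, 0 < v →
    ν {x | ENNReal.ofReal v < G x y} ≤ ENNReal.ofReal ((B / v) ^ (σ * β))

variable {M N : Type*} [MeasurableSpace M] [MeasurableSpace N] {μ : Measure M} {ν : Measure N}

section OneVariable

variable {u : M → ℝ≥0∞} {β c r τ : ℝ}

/-- Doubling a truncation level amounts to multiplying its scale r by 2^{-β}, which stays in the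
range (0, τ]. -/
theorem dyadic_tail_le (hβ : 0 < β) (hr : 0 < r) (hrτ : r ≤ τ)
    (h : ∀ r, 0 < r → r ≤ τ → μ {y | cut β c r < u y} ≤ ENNReal.ofReal r) (j : ℕ) :
    μ {y | 2 ^ j * cut β c r < u y} ≤ ENNReal.ofReal r * (2 ^ (-β)) ^ j := by
  rw [← cut_mul_two_pow hβ hr, ← ofReal_mul_two_rpow_pow hr]
  have h1 : (2 ^ (-β) : ℝ) ≤ 1 := Real.rpow_le_one_of_one_le_of_nonpos (by norm_num) (by linarith)
  have h2 : (2 ^ (-β) : ℝ) ^ j ≤ 1 := pow_le_one₀ (by positivity) h1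
  exact h _ (by positivity) (by nlinarith)

theorem lintegral_keep_Ioi_rpow_le (hu : Measurable u) (hβ : 0 < β) (hc : 0 < c) (hr : 0 < r)
    (hrτ : r ≤ τ) (h : ∀ r, 0 < r → r ≤ τ → μ {y | cut β c r < u y} ≤ ENNReal.ofReal r)
    {a : ℝ} (ha : 0 < a) :
    ∫⁻ y, keep (Ioi (cut β c r)) (u y) ^ a ∂μ ≤
      tailConst a β * cut β c r ^ a * ENNReal.ofReal r := by
  rw [lintegral_keep_rpow hu measurableSet_Ioi ha]
  exact lintegral_tail_rpow_le hu ha.le (cut_ne_zero hc hr) (dyadic_tail_le hβ hr hrτ h)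

/-- About log(r/r') / (β log 2) dyadic shells separate the two levels, and each contributes at most
2^β c^β because cut^β · r = c^β. -/
theorem lintegral_keep_Ioc_rpow_le (hu : Measurable u) (hβ : 0 < β) (hc : 0 < c) (hr : 0 < r)
    (hrτ : r ≤ τ) (h : ∀ r, 0 < r → r ≤ τ → μ {y | cut β c r < u y} ≤ ENNReal.ofReal r)
    {r' : ℝ} (hr' : 0 < r') (hrr : r' ≤ r) :
    ∫⁻ y, keep (Ioc (cut β c r) (cut β c r')) (u y) ^ β ∂μ ≤
      ENNReal.ofReal ((1 / (β * Real.log 2) + 1) * (2 ^ β * c ^ β) * (1 + Real.log (r / r'))) := by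
  have hlog2 : 0 < Real.log 2 := Real.log_pos one_lt_two
  have hlog : 0 ≤ Real.log (r / r') := Real.log_nonneg ((one_le_div hr').2 hrr)
  set L := Real.log (r / r') / (β * Real.log 2) with hL
  have hL0 : 0 ≤ L := by positivity
  set n := ⌈L⌉₊
  have hle : cut β c r' ≤ 2 ^ n * cut β c r := by
    rw [← cut_mul_two_pow hβ hr]
    refine ENNReal.ofReal_le_ofReal (mul_le_mul_of_nonneg_left ?_ hc.le)
    refine Real.rpow_le_rpow_of_nonpos (by positivity) ?_ (by simp [hβ.le])
    have hn : L ≤ n := Nat.le_ceil L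
    rw [hL, div_le_iff₀ (by positivity)] at hn
    have h3 : r / r' ≤ Real.exp (n * (β * Real.log 2)) := by
      rwa [← Real.log_le_iff_le_exp (by positivity)]
    have h4 : ((2 : ℝ) ^ (-β)) ^ n = (Real.exp (n * (β * Real.log 2)))⁻¹ := by
      rw [← Real.rpow_natCast, ← Real.rpow_mul (by norm_num), Real.rpow_def_of_pos (by norm_num),
        ← Real.exp_neg]
      congr 1
      ring
    rw [h4, ← div_eq_mul_inv, div_le_iff₀ (by positivity)]
    rwa [div_le_iff₀ hr', mul_comm] at h3
  rw [lintegral_keep_rpow hu measurableSet_Ioc hβ]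
  refine (lintegral_mono_set ?_).trans ((lintegral_middle_rpow_le hu hβ.le (cut_ne_zero hc hr)
    cut_ne_top (dyadic_tail_le hβ hr hrτ h) n).trans ?_)
  · exact fun y hy => ⟨hy.1, hy.2.trans hle⟩
  rw [mul_assoc (2 ^ β), cut_rpow_mul hβ hc hr]
  have h2 : (2 : ℝ≥0∞) ^ β = ENNReal.ofReal (2 ^ β) := by
    rw [← ENNReal.ofReal_rpow_of_pos (by norm_num)]; simp
  rw [h2, ← ENNReal.ofReal_natCast n, ← ENNReal.ofReal_mul (by positivity),
    ← ENNReal.ofReal_mul (by positivity)]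
  refine ENNReal.ofReal_le_ofReal ?_
  have hn : (n : ℝ) ≤ L + 1 := (Nat.ceil_lt_add_one hL0).le
  have : L + 1 ≤ (1 / (β * Real.log 2) + 1) * (1 + Real.log (r / r')) := by
    have h5 : L = 1 / (β * Real.log 2) * Real.log (r / r') := by rw [hL]; ring
    have h6 : 0 ≤ 1 / (β * Real.log 2) := by positivity
    rw [h5]
    nlinarith
  calc (n : ℝ) * (2 ^ β * c ^ β)
      ≤ ((1 / (β * Real.log 2) + 1) * (1 + Real.log (r / r'))) * (2 ^ β * c ^ β) := by
        gcongr; linarith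
    _ = _ := by ring

end OneVariable

/-- Hölder's inequality for `lintegral` in terms of bounds of the two factors. -/
theorem lintegral_mul_le_of_rpow_le {β p : ℝ} (hp : β.HolderConjugate p) {u v : M → ℝ≥0∞}
    (hu : Measurable u) (hv : Measurable v) {a b : ℝ≥0∞} (ha : ∫⁻ y, u y ^ β ∂μ ≤ a)
    (hb : ∫⁻ y, v y ^ p ∂μ ≤ b) : ∫⁻ y, u y * v y ∂μ ≤ a ^ (1 / β) * b ^ (1 / p) :=
  (ENNReal.lintegral_mul_le_Lp_mul_Lq μ hp hu.aemeasurable hv.aemeasurable).trans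
    (mul_le_mul' (ENNReal.rpow_le_rpow ha hp.one_div_nonneg)
      (ENNReal.rpow_le_rpow hb hp.symm.one_div_nonneg))

/-! ### Schur type estimate for the singular part of the kernel -/

section Schur

/-- The exponent splitting a kernel in the Schur type estimate. -/
noncomputable def schurExp (β p σ : ℝ) : ℝ := min (1 / 2) (σ * β / (2 * p))

/-- The constant in the Schur type estimate of the singular part of the kernel. -/
noncomputable def schurConst (β p σ B c : ℝ) : ℝ≥0∞ :=
  tailConst ((1 - schurExp β p σ) * β) β ^ (p / β) * tailConst (schurExp β p σ * p) (σ * β) *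
    ENNReal.ofReal (c ^ p * B ^ (σ * β) / c ^ (σ * β))

variable {β p σ A B c K J τ : ℝ} {G : N → M → ℝ≥0∞}

/-- With e the splitting exponent, e > 0 gives (1 - e)β < β and the last bound gives ep < σβ: these
are the conditions for both `tailConst` factors to be finite. -/
theorem schurExp_spec (hp : β.HolderConjugate p) (hσ : 0 < σ) :
    0 < schurExp β p σ ∧ schurExp β p σ < 1 ∧ schurExp β p σ * p < σ * β := by
  have hβ := hp.pos
  have hp0 := hp.symm.pos
  have h : 0 < σ * β / (2 * p) := by positivity
  refine ⟨lt_min (by norm_num) h, (min_le_left _ _).trans_lt (by norm_num), ?_⟩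
  have : schurExp β p σ * p ≤ σ * β / (2 * p) * p := by
    gcongr; exact min_le_right _ _
  have h2 : σ * β / (2 * p) * p = σ * β / 2 := by field_simp
  have : 0 < σ * β := by positivity
  linarith

theorem schurConst_ne_top (hp : β.HolderConjugate p) (hσ : 0 < σ) :
    schurConst β p σ B c ≠ ∞ := by
  obtain ⟨h0, h1, h2⟩ := schurExp_spec hp hσ
  have hβ := hp.pos
  have hp0 := hp.symm.pos
  refine ENNReal.mul_ne_top (ENNReal.mul_ne_top (ENNReal.rpow_ne_top_of_nonneg (by positivity)
    (tailConst_ne_top ?_ ?_)) (tailConst_ne_top (by positivity) h2)) ENNReal.ofReal_ne_top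
  · exact mul_nonneg (by linarith) hβ.le
  · nlinarith

theorem schur_scaling (hβ : 0 < β) (hp0 : 0 < p) (hB : 0 < B) (hc : 0 < c) {r e s : ℝ}
    (hr : 0 < r) (hs : s = c * r ^ (-(1 / β))) :
    (s ^ ((1 - e) * β) * r) ^ (p / β) * (s ^ (e * p) * (B / s) ^ (σ * β)) =
      c ^ p * B ^ (σ * β) / c ^ (σ * β) * r ^ σ := by
  have hs0 : 0 < s := by rw [hs]; positivity
  have e1 : (s ^ ((1 - e) * β) * r) ^ (p / β) = s ^ ((1 - e) * p) * r ^ (p / β) := by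
    rw [Real.mul_rpow (by positivity) hr.le, ← Real.rpow_mul hs0.le]
    congr 2
    field_simp
  have e2 : s ^ ((1 - e) * p) * s ^ (e * p) = s ^ p := by
    rw [← Real.rpow_add hs0]; congr 1; ring
  have e3 : s ^ p * r ^ (p / β) = c ^ p := by
    rw [hs, Real.mul_rpow hc.le (by positivity), ← Real.rpow_mul hr.le, mul_assoc,
      ← Real.rpow_add hr]
    have : -(1 / β) * p + p / β = 0 := by ring
    rw [this]; simp
  have e4 : s ^ (σ * β) = c ^ (σ * β) / r ^ σ := by
    rw [hs, Real.mul_rpow hc.le (by positivity), ← Real.rpow_mul hr.le]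
    have : -(1 / β) * (σ * β) = -σ := by field_simp
    rw [this, Real.rpow_neg hr.le]
    rfl
  rw [e1, Real.div_rpow hB.le hs0.le, e4]
  calc _ = (s ^ ((1 - e) * p) * s ^ (e * p)) * r ^ (p / β) *
      (B ^ (σ * β) / (c ^ (σ * β) / r ^ σ)) := by ring
    _ = _ := by
      rw [e2, e3]
      field_simp

/-- Write the singular kernel as H = H^{1-e} H^e. Hölder in y uses the weak bound in y for the first
factor; after Tonelli, the weak bound in x controls ∫ H^{ep} dν. The powers of r combine to r^σ,
which is what will be compared with ν(F). -/
theorem KernelBounds.lintegral_singular_rpow_le [SFinite μ] [SFinite ν]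
    (hG : KernelBounds μ ν G β σ A B c K J τ) (hp : β.HolderConjugate p) (hσ : 0 < σ)
    (hB : 0 < B) (hc : 0 < c) {r : ℝ} (hr : 0 < r) (hrτ : r ≤ τ) {g : M → ℝ≥0∞}
    (hg : Measurable g) :
    ∫⁻ x, (∫⁻ y, keep (Ioi (cut β c r)) (G x y) * g y ∂μ) ^ p ∂ν ≤
      schurConst β p σ B c * ENNReal.ofReal (r ^ σ) * ∫⁻ y, g y ^ p ∂μ := by
  obtain ⟨he0, he1, he2⟩ := schurExp_spec hp hσ
  have hβ := hp.pos
  have hp0 := hp.symm.pos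
  set e := schurExp β p σ with he
  set s := cut β c r with hs
  set H : N → M → ℝ≥0∞ := fun x y => keep (Ioi s) (G x y) with hH
  have hHm : Measurable (Function.uncurry H) := (measurable_keep measurableSet_Ioi).comp
    hG.measurable
  have hHx : ∀ x, Measurable (H x) := fun x => hHm.comp measurable_prodMk_left
  set T := tailConst ((1 - e) * β) β * s ^ ((1 - e) * β) * ENNReal.ofReal r with hT
  have hx : ∀ᵐ x ∂ν, (∫⁻ y, H x y * g y ∂μ) ^ p ≤
      T ^ (p / β) * ∫⁻ y, H x y ^ (e * p) * g y ^ p ∂μ := by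
    filter_upwards [hG.tail_le] with x hx
    have h1 : ∫⁻ y, (H x y ^ (1 - e)) ^ β ∂μ ≤ T := by
      simp_rw [← ENNReal.rpow_mul]
      exact lintegral_keep_Ioi_rpow_le (hG.measurable.comp measurable_prodMk_left) hβ hc hr hrτ
        hx (mul_pos (by linarith) hβ)
    have h2 : ∀ y, H x y * g y = H x y ^ (1 - e) * (H x y ^ e * g y) := fun y => by
      rw [← mul_assoc, ← ENNReal.rpow_add_of_nonneg _ _ (by linarith) he0.le]
      simp
    have h3 := lintegral_mul_le_of_rpow_le hp ((hHx x).pow_const (1 - e))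
      (v := fun y => H x y ^ e * g y) (((hHx x).pow_const e).mul hg) h1 le_rfl
    simp_rw [h2]
    refine (ENNReal.rpow_le_rpow h3 hp0.le).trans (le_of_eq ?_)
    rw [ENNReal.mul_rpow_of_nonneg _ _ hp0.le, ← ENNReal.rpow_mul, ← ENNReal.rpow_mul]
    have e1 : 1 / β * p = p / β := by ring
    have e2 : 1 / p * p = 1 := by field_simp
    rw [e1, e2, ENNReal.rpow_one]
    congr 1
    refine lintegral_congr fun y => ?_
    rw [ENNReal.mul_rpow_of_nonneg _ _ hp0.le, ← ENNReal.rpow_mul]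
  have hsreal : 0 < c * r ^ (-(1 / β)) := by positivity
  have hy : ∀ᵐ y ∂μ, ∫⁻ x, H x y ^ (e * p) ∂ν ≤ tailConst (e * p) (σ * β) * s ^ (e * p) *
      ENNReal.ofReal ((B / (c * r ^ (-(1 / β)))) ^ (σ * β)) := by
    filter_upwards [hG.dual_tail_le] with y hy
    have hGy : Measurable fun x => G x y := hG.measurable.comp measurable_prodMk_right
    simp only [hH]
    rw [lintegral_keep_rpow hGy measurableSet_Ioi (by positivity)]
    refine lintegral_tail_rpow_le hGy (by positivity) (cut_ne_zero hc hr) fun j => ?_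
    have h2 : (2 : ℝ≥0∞) ^ j * s = ENNReal.ofReal (2 ^ j * (c * r ^ (-(1 / β)))) := by
      rw [ENNReal.ofReal_mul (by positivity), ENNReal.ofReal_pow (by norm_num)]; simp [hs, cut]
    rw [h2]
    refine (hy _ (by positivity)).trans (le_of_eq ?_)
    have h3 : ∀ w : ℝ, 0 < w → (B / w) ^ (σ * β) * ((2 : ℝ) ^ (-(σ * β))) ^ j =
        (B / (2 ^ j * w)) ^ (σ * β) := by
      intro w hw
      rw [← Real.rpow_natCast, ← Real.rpow_mul zero_le_two, mul_comm (-(σ * β)) (j : ℝ),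
        Real.rpow_mul zero_le_two, Real.rpow_natCast, Real.rpow_neg (by positivity),
        ← Real.inv_rpow (by positivity), ← Real.mul_rpow (by positivity) (by positivity)]
      congr 1
      field_simp
    rw [← h3 _ hsreal, ofReal_mul_two_rpow_pow (by positivity)]
  have hm2 : Measurable (Function.uncurry fun x y => H x y ^ (e * p) * g y ^ p) :=
    (hHm.pow_const _).mul ((hg.comp measurable_snd).pow_const _)
  calc ∫⁻ x, (∫⁻ y, H x y * g y ∂μ) ^ p ∂ν
      ≤ ∫⁻ x, T ^ (p / β) * ∫⁻ y, H x y ^ (e * p) * g y ^ p ∂μ ∂ν := lintegral_mono_ae hx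
    _ = T ^ (p / β) * ∫⁻ y, ∫⁻ x, H x y ^ (e * p) * g y ^ p ∂ν ∂μ := by
        rw [lintegral_const_mul _ hm2.lintegral_prod_right,
          lintegral_lintegral_swap hm2.aemeasurable]
    _ = T ^ (p / β) * ∫⁻ y, (∫⁻ x, H x y ^ (e * p) ∂ν) * g y ^ p ∂μ := by
        congr 1
        refine lintegral_congr fun y => ?_
        rw [lintegral_mul_const]
        exact (hHm.comp measurable_prodMk_right).pow_const _
    _ ≤ T ^ (p / β) * ∫⁻ y, (tailConst (e * p) (σ * β) * s ^ (e * p) *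
          ENNReal.ofReal ((B / (c * r ^ (-(1 / β)))) ^ (σ * β))) * g y ^ p ∂μ := by
        refine mul_le_mul_right (lintegral_mono_ae ?_) _
        filter_upwards [hy] with y hy
        exact mul_le_mul_left hy _
    _ = schurConst β p σ B c * ENNReal.ofReal (r ^ σ) * ∫⁻ y, g y ^ p ∂μ := by
        rw [lintegral_const_mul _ (hg.pow_const _), ← mul_assoc]
        congr 1
        have h5 : T ^ (p / β) = tailConst ((1 - e) * β) β ^ (p / β) *
            ENNReal.ofReal (((c * r ^ (-(1 / β))) ^ ((1 - e) * β) * r) ^ (p / β)) := by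
          rw [hT, mul_assoc, ENNReal.mul_rpow_of_nonneg _ _ (by positivity), hs, cut,
            ENNReal.ofReal_rpow_of_pos hsreal, ← ENNReal.ofReal_mul (by positivity),
            ENNReal.ofReal_rpow_of_nonneg (by positivity) (by positivity)]
        have h6 : ENNReal.ofReal (c ^ p * B ^ (σ * β) / c ^ (σ * β)) * ENNReal.ofReal (r ^ σ) =
            ENNReal.ofReal (((c * r ^ (-(1 / β))) ^ ((1 - e) * β) * r) ^ (p / β)) *
              (ENNReal.ofReal ((c * r ^ (-(1 / β))) ^ (e * p)) *
                ENNReal.ofReal ((B / (c * r ^ (-(1 / β)))) ^ (σ * β))) := by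
          rw [← ENNReal.ofReal_mul (by positivity), ← ENNReal.ofReal_mul (by positivity),
            ← ENNReal.ofReal_mul (by positivity), schur_scaling hβ hp0 hB hc hr rfl]
        rw [h5, schurConst, ← he, hs, cut, ENNReal.ofReal_rpow_of_pos hsreal,
          mul_assoc _ (ENNReal.ofReal (c ^ p * B ^ (σ * β) / c ^ (σ * β))), h6]
        ring

end Schur

/-! ### Splitting off the largest values of a density -/

section Split

/-- Bathtub principle: θ is 1 on {g > h} and a fraction ρ on {g = h}, since μ may have atoms or g
plateaus. If h ≠ 0 the total mass of θ is exactly r, which yields the last bound; if h = 0 that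
bound is trivial. -/
theorem exists_weight {g : M → ℝ≥0∞} (hg : Measurable g) {p : ℝ} (hp : 0 < p)
    (hgp : ∫⁻ y, g y ^ p ∂μ ≠ ∞) (r : ℝ) :
    ∃ (θ : M → ℝ≥0∞) (h : ℝ≥0∞), Measurable θ ∧ (∀ y, θ y ≤ 1) ∧ ∫⁻ y, θ y ∂μ ≤ ENNReal.ofReal r ∧
      (∀ y, (1 - θ y) * g y ≤ h) ∧ ENNReal.ofReal r * h ^ p ≤ ∫⁻ y, θ y * g y ^ p ∂μ := by
  set R := ENNReal.ofReal r with hR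
  set h := rearrangement μ g r with hh
  set a := μ {y | h < g y} with ha
  set b := μ {y | g y = h} with hb
  have haR : a ≤ R := measure_lt_le_of_rearrangement_le le_rfl
  have hma : MeasurableSet {y | h < g y} := measurableSet_lt measurable_const hg
  have hmb : MeasurableSet {y | g y = h} := measurableSet_eq_fun hg measurable_const
  have hab : h ≠ 0 → R ≤ a + b := by
    intro h0
    have hle : a + b = μ {y | h ≤ g y} := by
      rw [ha, hb, ← measure_union _ hmb]
      · congr 1
        ext y
        simp only [mem_union, mem_ofPred_eq]
        rw [le_iff_lt_or_eq, eq_comm (a := h)]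
      · rw [Set.disjoint_left]
        intro y (hy : h < g y) (hy' : g y = h)
        exact hy.ne' hy'
    obtain ⟨u, hu, hu1, hu2⟩ := exists_seq_strictMono_tendsto' (pos_iff_ne_zero.2 h0)
    have hset : {y | h ≤ g y} = ⋂ n, {y | u n < g y} := by
      ext y
      simp only [mem_ofPred_eq, mem_iInter]
      exact ⟨fun hy n => (hu1 n).2.trans_le hy,
        fun hy => le_of_tendsto' hu2 fun n => (hy n).le⟩
    have hanti : Antitone fun n => {y | u n < g y} := fun i j hij y hy =>
      (hu.monotone hij).trans_lt hy
    -- Continuity from above needs one set of finite measure; Chebyshev and g ∈ L^p provide it.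
    have hfin : μ {y | u 0 < g y} ≠ ∞ := by
      have h1 := mul_meas_ge_le_lintegral (μ := μ) (hg.pow_const p) (u 0 ^ p)
      have h2 : 0 < u 0 ^ p :=
        ENNReal.rpow_pos (hu1 0).1 ((hu1 0).2.trans_le le_top).ne
      intro htop
      have h3 : μ {y | u 0 ^ p ≤ g y ^ p} = ∞ := by
        rw [eq_top_iff, ← htop]
        exact measure_mono fun y (hy : u 0 < g y) => ENNReal.rpow_le_rpow hy.le hp.le
      rw [h3, ENNReal.mul_top h2.ne'] at h1
      exact hgp (top_le_iff.1 h1)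
    rw [hle, hset, hanti.measure_iInter (fun n => (measurableSet_lt measurable_const
      hg).nullMeasurableSet) ⟨0, hfin⟩]
    refine le_iInf fun n => ?_
    by_contra! hlt
    exact absurd (sInf_le (show u n ∈ {s : ℝ≥0∞ | 0 < s ∧ μ {y | s < g y} ≤ R} from
      ⟨(hu1 n).1, hlt.le⟩)) (not_le.2 (hu1 n).2)
  obtain ⟨ρ, hρ1, hρ2, hρ3⟩ : ∃ ρ : ℝ≥0∞, ρ ≤ 1 ∧ a + ρ * b ≤ R ∧ (h ≠ 0 → R ≤ a + ρ * b) := by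
    by_cases h0 : h = 0
    · exact ⟨0, by simp, by simpa using haR, fun hc => absurd h0 hc⟩
    have hRab := hab h0
    rcases eq_or_ne b 0 with hb0 | hb0
    · refine ⟨0, by simp, by simpa using haR, fun _ => ?_⟩
      simpa [hb0] using hRab
    rcases eq_or_ne b ∞ with hbt | hbt
    · exfalso
      have h1 := mul_meas_ge_le_lintegral (μ := μ) (hg.pow_const p) (h ^ p)
      have hmono : μ {y | g y = h} ≤ μ {y | h ^ p ≤ g y ^ p} :=
        measure_mono fun y (hy : g y = h) => by simp [hy]
      rw [← hb, hbt, top_le_iff] at hmono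
      rw [hmono, ENNReal.mul_top] at h1
      · exact hgp (top_le_iff.1 h1)
      · intro h2
        rw [ENNReal.rpow_eq_zero_iff] at h2
        rcases h2 with h2 | h2
        · exact h0 h2.1
        · linarith [h2.2]
    · have hdiv : (R - a) / b * b = R - a := ENNReal.div_mul_cancel hb0 hbt
      refine ⟨(R - a) / b, ?_, ?_, fun _ => ?_⟩
      · rw [ENNReal.div_le_iff hb0 hbt, one_mul]
        exact tsub_le_iff_left.2 hRab
      · rw [hdiv, add_tsub_cancel_of_le haR]
      · rw [hdiv, add_tsub_cancel_of_le haR]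
  set θ : M → ℝ≥0∞ := fun y =>
    {y | h < g y}.indicator (fun _ => 1) y + {y | g y = h}.indicator (fun _ => ρ) y with hθ
  have hθ1 : ∀ y, h < g y → θ y = 1 := fun y hy => by simp [hθ, hy, hy.ne']
  have hθ2 : ∀ y, g y = h → θ y = ρ := fun y hy => by simp [hθ, hy]
  have hθ3 : ∀ y, g y < h → θ y = 0 := fun y hy => by simp [hθ, hy.ne, hy.le]
  have hint : ∫⁻ y, θ y ∂μ = a + ρ * b := by
    rw [hθ, lintegral_add_left (measurable_const.indicator hma), lintegral_indicator_const hma,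
      lintegral_indicator_const hmb, one_mul]
  have hθm : Measurable θ := (measurable_const.indicator hma).add (measurable_const.indicator hmb)
  refine ⟨θ, h, hθm, fun y => ?_, ?_, fun y => ?_, ?_⟩
  · rcases lt_trichotomy (g y) h with hy | hy | hy
    · simp [hθ3 y hy]
    · rw [hθ2 y hy]; exact hρ1
    · rw [hθ1 y hy]
  · rw [hint]; exact hρ2
  · rcases le_or_gt (g y) h with hy | hy
    · exact (mul_le_of_le_one_left' tsub_le_self).trans hy
    · simp [hθ1 y hy]
  · by_cases h0 : h = 0
    · simp [h0, hp]
    calc R * h ^ p ≤ (a + ρ * b) * h ^ p := mul_le_mul_left (hρ3 h0) _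
      _ = ∫⁻ y, θ y * h ^ p ∂μ := by rw [lintegral_mul_const _ hθm, hint]
      _ ≤ _ := by
        refine lintegral_mono fun y => ?_
        rcases lt_or_ge (g y) h with hy | hy
        · simp [hθ3 y hy]
        · exact mul_le_mul_right (ENNReal.rpow_le_rpow hy hp.le) _

end Split

end AdamsIneq

/-! ### The two-scale estimate of a potential -/

namespace AdamsIneq

variable {M N : Type*} [MeasurableSpace M] [MeasurableSpace N] {μ : Measure M} {ν : Measure N}

/-- The constant in the two-scale estimate of a potential. -/
noncomputable def scaleConst (β p σ B c : ℝ) : ℝ :=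
  c + ((1 / (β * Real.log 2) + 1) * (2 ^ β * c ^ β)) ^ (1 / β) +
    (schurConst β p σ B c ^ (1 / p)).toReal + (tailConst 1 β).toReal * c

variable {β p σ A B c K J τ : ℝ} {G : N → M → ℝ≥0∞}

theorem scaleConst_pos (hp : β.HolderConjugate p) (hc : 0 < c) : 0 < scaleConst β p σ B c := by
  have hβ := hp.pos
  have hlog2 : 0 < Real.log 2 := Real.log_pos one_lt_two
  unfold scaleConst
  positivity

theorem cut_mul_eq (hp : β.HolderConjugate p) (hc : 0 < c) {r : ℝ} (hr : 0 < r) :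
    cut β c r * ENNReal.ofReal r = ENNReal.ofReal c * ENNReal.ofReal r ^ (1 / p) := by
  rw [cut, ENNReal.ofReal_rpow_of_pos hr, ← ENNReal.ofReal_mul (by positivity),
    ← ENNReal.ofReal_mul hc.le, mul_assoc]
  congr 2
  nth_rewrite 2 [← Real.rpow_one r]
  rw [← Real.rpow_add hr]
  congr 1
  have := hp.inv_add_inv_eq_one
  simp only [one_div]
  linarith

theorem cut_mul_rpow_eq (hc : 0 < c) {r : ℝ} (hr : 0 < r) :
    cut β c r * ENNReal.ofReal r ^ (1 / β) = ENNReal.ofReal c := by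
  rw [cut, ENNReal.ofReal_rpow_of_pos hr, ← ENNReal.ofReal_mul (by positivity), mul_assoc,
    ← Real.rpow_add hr]
  simp

theorem mul_rpow_le_mul_rpow {θ z : ℝ≥0∞} (hθ : θ ≤ 1) (hp : 1 ≤ p) :
    (θ * z) ^ p ≤ θ * z ^ p := by
  rw [ENNReal.mul_rpow_of_nonneg _ _ (by linarith)]
  exact mul_le_mul_left (ENNReal.rpow_le_self_of_le_one hθ hp) _

section Pointwise

variable {u v : M → ℝ≥0∞} {r r' : ℝ}

/-- The part of a potential where the kernel is at most `c r^{-1/β}` and the density is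
concentrated on a set of measure at most `r`. -/
theorem lintegral_keep_Iic_mul_weight_le (hp : β.HolderConjugate p) (hc : 0 < c) (hr : 0 < r)
    {θ : M → ℝ≥0∞} (hθ : Measurable θ) (hv : Measurable v)
    (hθr : ∫⁻ y, θ y ∂μ ≤ ENNReal.ofReal r) {D : ℝ≥0∞} (hD : ∫⁻ y, θ y * v y ^ p ∂μ ≤ D) :
    ∫⁻ y, keep (Iic (cut β c r)) (u y) * (θ y * v y) ∂μ ≤ ENNReal.ofReal c * D ^ (1 / p) := by
  have hβ := hp.pos
  have hp0 := hp.symm.pos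
  have h1 : ∫⁻ y, θ y * v y ∂μ ≤ ENNReal.ofReal r ^ (1 / β) * D ^ (1 / p) := by
    have hsplit : ∀ y, θ y * v y = θ y ^ (1 / β) * (θ y ^ (1 / p) * v y) := fun y => by
      rw [← mul_assoc, ← ENNReal.rpow_add_of_nonneg _ _ (by positivity) (by positivity),
        one_div, one_div, hp.inv_add_inv_eq_one, ENNReal.rpow_one]
    simp_rw [hsplit]
    refine lintegral_mul_le_of_rpow_le hp (hθ.pow_const _)
      (v := fun y => θ y ^ (1 / p) * v y) ((hθ.pow_const _).mul hv) ?_ ?_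
    · simp_rw [← ENNReal.rpow_mul, one_div_mul_cancel hβ.ne', ENNReal.rpow_one]
      exact hθr
    · simp_rw [ENNReal.mul_rpow_of_nonneg _ _ hp0.le, ← ENNReal.rpow_mul,
        one_div_mul_cancel hp0.ne', ENNReal.rpow_one]
      exact hD
  calc ∫⁻ y, keep (Iic (cut β c r)) (u y) * (θ y * v y) ∂μ
      ≤ ∫⁻ y, cut β c r * (θ y * v y) ∂μ :=
        lintegral_mono fun y => mul_le_mul_left (keep_Iic_le _ _) _
    _ = cut β c r * ∫⁻ y, θ y * v y ∂μ := lintegral_const_mul _ (hθ.mul hv)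
    _ ≤ cut β c r * (ENNReal.ofReal r ^ (1 / β) * D ^ (1 / p)) := mul_le_mul_right h1 _
    _ = _ := by rw [← mul_assoc, cut_mul_rpow_eq hc hr]

/-- The part of a potential where the kernel is large and the density is bounded. -/
theorem lintegral_keep_Ioi_mul_bounded_le (hp : β.HolderConjugate p) (hc : 0 < c) (hr : 0 < r)
    (hrτ : r ≤ τ) (hu : Measurable u)
    (htail : ∀ r, 0 < r → r ≤ τ → μ {y | cut β c r < u y} ≤ ENNReal.ofReal r)
    {h D : ℝ≥0∞} (hv : ∀ y, v y ≤ h) (hD : ENNReal.ofReal r * h ^ p ≤ D) :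
    ∫⁻ y, keep (Ioi (cut β c r)) (u y) * v y ∂μ ≤
      tailConst 1 β * ENNReal.ofReal c * D ^ (1 / p) := by
  have hβ := hp.pos
  have hp0 := hp.symm.pos
  have h1 := lintegral_keep_Ioi_rpow_le hu hβ hc hr hrτ htail one_pos
  simp only [ENNReal.rpow_one] at h1
  have h2 : ENNReal.ofReal r ^ (1 / p) * h ≤ D ^ (1 / p) := by
    refine le_trans (le_of_eq ?_) (ENNReal.rpow_le_rpow hD (by positivity))
    rw [ENNReal.mul_rpow_of_nonneg _ _ (by positivity), ← ENNReal.rpow_mul,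
      mul_one_div_cancel hp0.ne', ENNReal.rpow_one]
  calc ∫⁻ y, keep (Ioi (cut β c r)) (u y) * v y ∂μ
      ≤ ∫⁻ y, keep (Ioi (cut β c r)) (u y) * h ∂μ :=
        lintegral_mono fun y => mul_le_mul_right (hv y) _
    _ = (∫⁻ y, keep (Ioi (cut β c r)) (u y) ∂μ) * h :=
        lintegral_mul_const _ ((measurable_keep measurableSet_Ioi).comp hu)
    _ ≤ tailConst 1 β * cut β c r * ENNReal.ofReal r * h := mul_le_mul_left h1 _
    _ = tailConst 1 β * ENNReal.ofReal c * (ENNReal.ofReal r ^ (1 / p) * h) := by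
        rw [mul_assoc (tailConst 1 β), cut_mul_eq hp hc hr]; ring
    _ ≤ _ := mul_le_mul_right h2 _

end Pointwise

/-- A potential is finite almost everywhere. -/
theorem KernelBounds.ae_lintegral_lt_top [SFinite μ] [SFinite ν]
    (hG : KernelBounds μ ν G β σ A B c K J τ) (hp : β.HolderConjugate p) (hσ : 0 < σ)
    (hB : 0 < B) (hc : 0 < c) (hτ : 0 < τ) {g : M → ℝ≥0∞} (hg : Measurable g)
    (hgp : ∫⁻ y, g y ^ p ∂μ ≠ ∞) :
    ∀ᵐ x ∂ν, ∫⁻ y, G x y * g y ∂μ < ∞ := by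
  have hβ := hp.pos
  have hp0 := hp.symm.pos
  have hm : Measurable fun x => ∫⁻ y, keep (Ioi (cut β c τ)) (G x y) * g y ∂μ := by
    have : Measurable (Function.uncurry fun x y => keep (Ioi (cut β c τ)) (G x y) * g y) :=
      ((measurable_keep measurableSet_Ioi).comp hG.measurable).mul (hg.comp measurable_snd)
    exact this.lintegral_prod_right
  -- Cut the kernel at scale τ: the singular part maps g into L^p by the Schur estimate, and Hölder
  -- bounds the truncated part.
  have h1 := hG.lintegral_singular_rpow_le hp hσ hB hc hτ le_rfl hg
  have h2 := ae_lt_top (hm.pow_const p) (h1.trans_lt (ENNReal.mul_lt_top (ENNReal.mul_lt_top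
    (schurConst_ne_top hp hσ).lt_top ENNReal.ofReal_lt_top) hgp.lt_top)).ne
  filter_upwards [h2, hG.trunc_le] with x hx hx'
  have hGx : Measurable (G x) := hG.measurable.comp measurable_prodMk_left
  have h3 : ∫⁻ y, keep (Iic (cut β c τ)) (G x y) * g y ∂μ < ∞ := by
    refine (lintegral_mul_le_of_rpow_le hp ((measurable_keep measurableSet_Iic).comp hGx) hg
      (hx' τ hτ le_rfl) le_rfl).trans_lt ?_
    exact ENNReal.mul_lt_top (ENNReal.rpow_lt_top_of_nonneg hp.one_div_nonneg
      ENNReal.ofReal_ne_top) (ENNReal.rpow_lt_top_of_nonneg hp.symm.one_div_nonneg hgp)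
  have h4 : ∫⁻ y, keep (Ioi (cut β c τ)) (G x y) * g y ∂μ < ∞ := by
    rwa [ENNReal.rpow_lt_top_iff_of_pos hp0] at hx
  calc ∫⁻ y, G x y * g y ∂μ
      ≤ ∫⁻ y, (keep (Iic (cut β c τ)) (G x y) * g y +
          keep (Ioi (cut β c τ)) (G x y) * g y) ∂μ := by
        refine lintegral_mono fun y => ?_
        rw [← add_mul]
        exact mul_le_mul_left (le_keep_add_keep _ _) _
    _ = _ := lintegral_add_left (((measurable_keep measurableSet_Iic).comp hGx).mul hg) _
    _ < ∞ := ENNReal.add_lt_top.2 ⟨h3, h4⟩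

/-- The two-scale estimate: the mass `δ ^ p` of the density at the scale `r` controls the size of
the potential on sets of smaller measure. -/
theorem KernelBounds.exists_two_scale_bound [SFinite μ] [SFinite ν]
    (hG : KernelBounds μ ν G β σ A B c K J τ) (hp : β.HolderConjugate p) (hσ : 0 < σ)
    (hA : 0 < A) (hB : 0 < B) (hc : 0 < c) (hK : 0 ≤ K) (hJ : 0 ≤ J)
    {g : M → ℝ≥0∞} (hg : Measurable g) (hgp : ∫⁻ y, g y ^ p ∂μ ≤ 1) {r : ℝ} (hr : 0 < r)
    (hrτ : r ≤ τ) :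
    ∃ δ : ℝ, 0 ≤ δ ∧ δ ≤ 1 ∧ ∀ r', 0 < r' → r' ≤ r → ∀ F : Set N, MeasurableSet F → ν F ≠ ∞ →
      ENNReal.ofReal (r' ^ σ) ≤ ν F → ∀ l : ℝ≥0∞, (∀ x ∈ F, l ≤ ∫⁻ y, G x y * g y ∂μ) →
      l ≤ ENNReal.ofReal (scaleConst β p σ B c * δ * (1 + Real.log (r / r')) ^ (1 / β) +
        (1 - δ ^ p) ^ (1 / p) * (A * (Real.log (τ / r) + J + K)) ^ (1 / β)) := by
  have hβ := hp.pos
  have hp0 := hp.symm.pos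
  have hp1 := hp.symm.lt
  obtain ⟨θ, h, hθm, hθ1, hθr, hh, hrh⟩ :=
    exists_weight hg hp0 (hgp.trans_lt ENNReal.one_lt_top).ne r
  set D := ∫⁻ y, θ y * g y ^ p ∂μ with hD
  have hD1 : D ≤ 1 := (lintegral_mono fun y => mul_le_of_le_one_left' (hθ1 y)).trans hgp
  have hDt : D ≠ ∞ := (hD1.trans_lt ENNReal.one_lt_top).ne
  have hδt : D ^ (1 / p) ≠ ∞ := ENNReal.rpow_ne_top_of_nonneg hp.symm.one_div_nonneg hDt
  have hδp : (D ^ (1 / p)).toReal ^ p = D.toReal := by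
    rw [← ENNReal.toReal_rpow, ← Real.rpow_mul ENNReal.toReal_nonneg, one_div_mul_cancel hp0.ne',
      Real.rpow_one]
  -- As p > 1 and 0 ≤ 1 - θ ≤ 1, (1 - θ)^p ≤ 1 - θ, so the fractional splitting loses no mass.
  have hrest : ∫⁻ y, ((1 - θ y) * g y) ^ p ∂μ ≤ 1 - D := by
    refine ENNReal.le_sub_of_add_le_right hDt ?_
    have hm : Measurable fun y => θ y * g y ^ p := hθm.mul (hg.pow_const p)
    rw [hD, ← lintegral_add_right _ hm]
    refine (lintegral_mono fun y => ?_).trans hgp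
    refine (add_le_add_left (mul_rpow_le_mul_rpow tsub_le_self hp1.le) _).trans ?_
    rw [← add_mul, tsub_add_cancel_of_le (hθ1 y), one_mul]
  have hconc : ∫⁻ y, (θ y * g y) ^ p ∂μ ≤ D :=
    lintegral_mono fun y => mul_rpow_le_mul_rpow (hθ1 y) hp1.le
  have h1m : Measurable fun y => θ y * g y := hθm.mul hg
  have h2m : Measurable fun y => (1 - θ y) * g y := (measurable_const.sub hθm).mul hg
  refine ⟨(D ^ (1 / p)).toReal, ENNReal.toReal_nonneg, ?_, ?_⟩
  · exact ENNReal.toReal_le_of_le_ofReal zero_le_one (by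
      simpa using ENNReal.rpow_le_one hD1 hp.symm.one_div_nonneg)
  intro r' hr' hrr F hF hFt hrF l hl
  have hlog : 0 ≤ Real.log (r / r') := Real.log_nonneg ((one_le_div hr').2 hrr)
  set Z : N → ℝ≥0∞ := fun x => ∫⁻ y, keep (Ioi (cut β c r')) (G x y) * (θ y * g y) ∂μ with hZ
  have hZm : Measurable Z := by
    have : Measurable (Function.uncurry fun x y =>
        keep (Ioi (cut β c r')) (G x y) * (θ y * g y)) :=
      ((measurable_keep measurableSet_Ioi).comp hG.measurable).mul (h1m.comp measurable_snd)
    exact this.lintegral_prod_right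
  have hF0 : ν F ≠ 0 := by
    refine (lt_of_lt_of_le ?_ hrF).ne'
    rw [ENNReal.ofReal_pos]; positivity
  have : IsFiniteMeasure (ν.restrict F) := ⟨by simpa using hFt.lt_top⟩
  -- Since ν(F) ≥ r'^σ, the Schur estimate bounds the average of Z^p over F by a constant times D.
  -- Some point of F is at most average while also avoiding the null sets of the kernel bounds.
  obtain ⟨x, hxF, hxt, hxc, hxZ⟩ : ∃ x ∈ F,
      (∀ r, 0 < r → r ≤ τ → μ {y | cut β c r < G x y} ≤ ENNReal.ofReal r) ∧
      (∀ r, 0 < r → r ≤ τ → ∫⁻ y, keep (Iic (cut β c r)) (G x y) ^ β ∂μ ≤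
        ENNReal.ofReal (A * (Real.log (τ / r) + J + K))) ∧
      Z x ^ p ≤ schurConst β p σ B c * D := by
    have hnull : ∀ᵐ x ∂ν.restrict F, x ∈ F ∧
        (∀ r, 0 < r → r ≤ τ → μ {y | cut β c r < G x y} ≤ ENNReal.ofReal r) ∧
        (∀ r, 0 < r → r ≤ τ → ∫⁻ y, keep (Iic (cut β c r)) (G x y) ^ β ∂μ ≤
          ENNReal.ofReal (A * (Real.log (τ / r) + J + K))) :=
      (ae_restrict_mem hF).and (ae_restrict_of_ae (hG.tail_le.and hG.trunc_le))
    obtain ⟨x, hx, hxZ⟩ := exists_notMem_null_le_laverage (μ := ν.restrict F)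
      (f := fun x => Z x ^ p) (by simpa [Measure.restrict_eq_zero] using hF0)
      (hZm.pow_const p).aemeasurable (ae_iff.1 hnull)
    have hx' := not_not.1 hx
    refine ⟨x, hx'.1, hx'.2.1, hx'.2.2, hxZ.trans ?_⟩
    rw [laverage_eq, Measure.restrict_apply_univ, ENNReal.div_le_iff hF0 hFt]
    refine (setLIntegral_le_lintegral F _).trans
      ((hG.lintegral_singular_rpow_le hp hσ hB hc hr' (hrr.trans hrτ) h1m).trans ?_)
    calc _ ≤ schurConst β p σ B c * ν F * D := by gcongr
      _ = _ := by ring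
  have hGx : Measurable (G x) := hG.measurable.comp measurable_prodMk_left
  have hGk : ∀ {S : Set ℝ≥0∞}, MeasurableSet S → Measurable fun y => keep S (G x y) :=
    fun hS => (measurable_keep hS).comp hGx
  -- The next four bounds are all proportional to δ = D^{1/p}, so their constants need not be sharp;
  -- only `b5` carries the sharp A.
  have b1 : ∫⁻ y, keep (Iic (cut β c r)) (G x y) * (θ y * g y) ∂μ ≤
      ENNReal.ofReal c * D ^ (1 / p) :=
    lintegral_keep_Iic_mul_weight_le hp hc hr hθm hg hθr le_rfl
  have b2 : ∫⁻ y, keep (Ioc (cut β c r) (cut β c r')) (G x y) * (θ y * g y) ∂μ ≤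
      ENNReal.ofReal ((1 / (β * Real.log 2) + 1) * (2 ^ β * c ^ β) *
        (1 + Real.log (r / r'))) ^ (1 / β) * D ^ (1 / p) :=
    lintegral_mul_le_of_rpow_le hp (hGk measurableSet_Ioc) h1m
      (lintegral_keep_Ioc_rpow_le hGx hβ hc hr hrτ hxt hr' hrr) hconc
  have b3 : Z x ≤ schurConst β p σ B c ^ (1 / p) * D ^ (1 / p) := by
    rw [← ENNReal.mul_rpow_of_nonneg _ _ hp.symm.one_div_nonneg, one_div, ENNReal.le_rpow_inv_iff hp0]
    exact hxZ
  have b4 : ∫⁻ y, keep (Ioi (cut β c r)) (G x y) * ((1 - θ y) * g y) ∂μ ≤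
      tailConst 1 β * ENNReal.ofReal c * D ^ (1 / p) :=
    lintegral_keep_Ioi_mul_bounded_le hp hc hr hrτ hGx hxt hh hrh
  have b5 : ∫⁻ y, keep (Iic (cut β c r)) (G x y) * ((1 - θ y) * g y) ∂μ ≤
      ENNReal.ofReal (A * (Real.log (τ / r) + J + K)) ^ (1 / β) * (1 - D) ^ (1 / p) :=
    lintegral_mul_le_of_rpow_le hp (hGk measurableSet_Iic) h2m (hxc r hr hrτ) hrest
  have hsum : ∫⁻ y, G x y * g y ∂μ ≤
      (∫⁻ y, keep (Iic (cut β c r)) (G x y) * (θ y * g y) ∂μ) +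
      (∫⁻ y, keep (Ioc (cut β c r) (cut β c r')) (G x y) * (θ y * g y) ∂μ) + Z x +
      (∫⁻ y, keep (Ioi (cut β c r)) (G x y) * ((1 - θ y) * g y) ∂μ) +
      ∫⁻ y, keep (Iic (cut β c r)) (G x y) * ((1 - θ y) * g y) ∂μ := by
    have hGm : ∀ {S : Set ℝ≥0∞} {v : M → ℝ≥0∞}, MeasurableSet S → Measurable v →
        Measurable fun y => keep S (G x y) * v y := fun hS hv => (hGk hS).mul hv
    simp only [hZ]
    rw [← lintegral_add_left (hGm measurableSet_Iic h1m),
      ← lintegral_add_right _ (hGm measurableSet_Ioi h1m),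
      ← lintegral_add_right _ (hGm measurableSet_Ioi h2m),
      ← lintegral_add_right _ (hGm measurableSet_Iic h2m)]
    refine lintegral_mono fun y => ?_
    have e1 : g y = θ y * g y + (1 - θ y) * g y := by
      rw [← add_mul, add_tsub_cancel_of_le (hθ1 y), one_mul]
    have e2 := le_keep_add_keep (cut β c r) (G x y)
    have e3 := e2.trans (add_le_add_right (keep_Ioi_le _ (cut β c r') _) _)
    calc G x y * g y = G x y * (θ y * g y) + G x y * ((1 - θ y) * g y) := by
          rw [← mul_add, ← e1]
      _ ≤ _ := add_le_add (mul_le_mul_left e3 _) (mul_le_mul_left e2 _)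
      _ = _ := by ring
  have hcs : schurConst β p σ B c ^ (1 / p) ≠ ∞ :=
    ENNReal.rpow_ne_top_of_nonneg hp.symm.one_div_nonneg (schurConst_ne_top hp hσ)
  have hct : tailConst 1 β ≠ ∞ := tailConst_ne_top zero_le_one hp.lt
  have hlog2 : 0 < Real.log 2 := Real.log_pos one_lt_two
  set m := (1 / (β * Real.log 2) + 1) * (2 ^ β * c ^ β) with hm
  have hm0 : 0 ≤ m := by positivity
  set δ := (D ^ (1 / p)).toReal with hδ
  have hδ0 : 0 ≤ δ := ENNReal.toReal_nonneg
  have hDδ : D ^ (1 / p) = ENNReal.ofReal δ := (ENNReal.ofReal_toReal hδt).symm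
  set L := (1 + Real.log (r / r')) ^ (1 / β) with hL
  have hL1 : 1 ≤ L := Real.one_le_rpow (by linarith) hp.one_div_nonneg
  have hlogτ : 0 ≤ Real.log (τ / r) := Real.log_nonneg ((one_le_div hr).2 hrτ)
  have hlast : ENNReal.ofReal (A * (Real.log (τ / r) + J + K)) ^ (1 / β) * (1 - D) ^ (1 / p) =
      ENNReal.ofReal ((1 - δ ^ p) ^ (1 / p) * (A * (Real.log (τ / r) + J + K)) ^ (1 / β)) := by
    have hDr : D.toReal ≤ 1 := ENNReal.toReal_le_of_le_ofReal zero_le_one (by simpa using hD1)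
    have h1D : 1 - D = ENNReal.ofReal (1 - D.toReal) := by
      rw [ENNReal.ofReal_sub _ ENNReal.toReal_nonneg, ENNReal.ofReal_toReal hDt,
        ENNReal.ofReal_one]
    rw [hδp, h1D, ENNReal.ofReal_rpow_of_nonneg (by positivity) hp.one_div_nonneg,
      ENNReal.ofReal_rpow_of_nonneg (by linarith) hp.symm.one_div_nonneg,
      ← ENNReal.ofReal_mul (by positivity), mul_comm]
  have hb2 : ENNReal.ofReal (m * (1 + Real.log (r / r'))) ^ (1 / β) =
      ENNReal.ofReal (m ^ (1 / β) * L) := by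
    rw [ENNReal.ofReal_rpow_of_nonneg (by positivity) hp.one_div_nonneg,
      Real.mul_rpow hm0 (by linarith)]
  have hδp1 : 0 ≤ 1 - δ ^ p := by
    rw [hδp, sub_nonneg]
    exact ENNReal.toReal_le_of_le_ofReal zero_le_one (by simpa using hD1)
  calc l ≤ ∫⁻ y, G x y * g y ∂μ := hl x hxF
    _ ≤ _ := hsum
    _ ≤ ENNReal.ofReal c * D ^ (1 / p) + ENNReal.ofReal (m * (1 + Real.log (r / r'))) ^ (1 / β) *
        D ^ (1 / p) + schurConst β p σ B c ^ (1 / p) * D ^ (1 / p) +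
        tailConst 1 β * ENNReal.ofReal c * D ^ (1 / p) +
        ENNReal.ofReal (A * (Real.log (τ / r) + J + K)) ^ (1 / β) * (1 - D) ^ (1 / p) :=
      add_le_add (add_le_add (add_le_add (add_le_add b1 b2) b3) b4) b5
    _ = ENNReal.ofReal ((c + m ^ (1 / β) * L + (schurConst β p σ B c ^ (1 / p)).toReal +
        (tailConst 1 β).toReal * c) * δ) + ENNReal.ofReal ((1 - δ ^ p) ^ (1 / p) *
          (A * (Real.log (τ / r) + J + K)) ^ (1 / β)) := by
      rw [hlast, hb2, hDδ, ← add_mul, ← add_mul, ← add_mul, ENNReal.ofReal_mul' hδ0,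
        ENNReal.ofReal_add (by positivity) (by positivity),
        ENNReal.ofReal_add (by positivity) (by positivity),
        ENNReal.ofReal_add (by positivity) (by positivity), ENNReal.ofReal_toReal hcs,
        ENNReal.ofReal_mul (q := c) ENNReal.toReal_nonneg, ENNReal.ofReal_toReal hct]
    _ ≤ _ := by
      rw [← ENNReal.ofReal_add (by positivity) (by positivity)]
      refine ENNReal.ofReal_le_ofReal (add_le_add_left ?_ _)
      have hs0 : 0 ≤ (schurConst β p σ B c ^ (1 / p)).toReal := ENNReal.toReal_nonneg
      have ht0 : 0 ≤ (tailConst 1 β).toReal * c := by positivity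
      have hle : c + m ^ (1 / β) * L + (schurConst β p σ B c ^ (1 / p)).toReal +
          (tailConst 1 β).toReal * c ≤ scaleConst β p σ B c * L := by
        rw [scaleConst, ← hm]
        nlinarith
      calc _ ≤ scaleConst β p σ B c * L * δ := mul_le_mul_of_nonneg_right hle hδ0
        _ = _ := by ring

end AdamsIneq

namespace AdamsIneq

/-! ### The Adams–Garsia counting argument for families of scales -/

section Garsia

variable {β p : ℝ}

theorem two_term_holder (hp : β.HolderConjugate p) {x₁ x₂ y₁ y₂ : ℝ} (hx₁ : 0 ≤ x₁) (hx₂ : 0 ≤ x₂)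
    (hy₁ : 0 ≤ y₁) (hy₂ : 0 ≤ y₂) (hx : x₁ ^ p + x₂ ^ p ≤ 1) :
    (x₁ * y₁ + x₂ * y₂) ^ β ≤ y₁ ^ β + y₂ ^ β := by
  have hβ := hp.pos
  have h := Real.inner_le_Lp_mul_Lq_of_nonneg (Finset.univ : Finset (Fin 2)) (f := ![x₁, x₂])
    (g := ![y₁, y₂]) hp.symm (by intro i _; fin_cases i <;> simpa) (by intro i _; fin_cases i <;> simpa)
  simp only [Fin.sum_univ_two, Matrix.cons_val_zero, Matrix.cons_val_one] at h
  have h2 : (x₁ ^ p + x₂ ^ p) ^ (1 / p) ≤ 1 :=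
    Real.rpow_le_one (by positivity) hx hp.symm.one_div_nonneg
  have h3 : x₁ * y₁ + x₂ * y₂ ≤ (y₁ ^ β + y₂ ^ β) ^ (1 / β) :=
    h.trans (mul_le_of_le_one_left (by positivity) h2)
  calc (x₁ * y₁ + x₂ * y₂) ^ β ≤ ((y₁ ^ β + y₂ ^ β) ^ (1 / β)) ^ β :=
        Real.rpow_le_rpow (by positivity) h3 hβ.le
    _ = y₁ ^ β + y₂ ^ β := by
        rw [← Real.rpow_mul (by positivity), one_div_mul_cancel hβ.ne', Real.rpow_one]

theorem rpow_one_div_rpow {a : ℝ} (ha : 0 ≤ a) {q : ℝ} (hq : 0 < q) : (a ^ (1 / q)) ^ q = a := by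
  rw [← Real.rpow_mul ha, one_div_mul_cancel hq.ne', Real.rpow_one]

/-- The pair (δ, (1 - δ^p)^{1/p}) is a unit vector in ℓ^p, so Hölder against (K, (T + K)^{1/β})
removes δ. -/
theorem level_le_of_one_scale (hp : β.HolderConjugate p) {K T δ n : ℝ} (hK : 0 ≤ K) (hT : 0 ≤ T)
    (hn : 0 ≤ n) (hδ : 0 ≤ δ) (hδ1 : δ ≤ 1)
    (h : n ^ (1 / β) ≤ K * δ + (1 - δ ^ p) ^ (1 / p) * (T + K) ^ (1 / β)) :
    n ≤ T + K + K ^ β := by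
  have hβ := hp.pos
  have hδp : δ ^ p ≤ 1 := Real.rpow_le_one hδ hδ1 hp.symm.nonneg
  have h1 := two_term_holder hp hδ (Real.rpow_nonneg (by linarith : 0 ≤ 1 - δ ^ p) (1 / p)) hK
    (Real.rpow_nonneg (by linarith : 0 ≤ T + K) (1 / β))
    (by rw [rpow_one_div_rpow (by linarith) hp.symm.pos]; linarith)
  rw [rpow_one_div_rpow (by linarith) hβ] at h1
  have h2 := Real.rpow_le_rpow (by positivity) h hβ.le
  rw [rpow_one_div_rpow hn hβ, mul_comm K δ] at h2
  linarith

/-- The constant in the estimate of the mass at a scale. -/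
noncomputable def massConst (β p K : ℝ) : ℝ :=
  2 * ((p * K * (p / 2) ^ (-(1 / p))) ^ β / β) + 2 * p * K + 2 * p

theorem massConst_pos (hp : β.HolderConjugate p) {K : ℝ} (hK : 0 ≤ K) : 0 < massConst β p K := by
  have := hp.pos
  have := hp.symm.pos
  unfold massConst
  positivity

/-- Young's inequality with weights (p/2)^{±1/p} bounds the linear term by w^p / 2 plus a constant,
so it can be absorbed. -/
theorem rpow_le_of_rpow_le_linear (hp : β.HolderConjugate p) {K w l : ℝ} (hK : 0 ≤ K)
    (hw : 0 ≤ w) (hl : 0 ≤ l) (h : w ^ p ≤ p * K * w + p * (l + K)) :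
    w ^ p ≤ massConst β p K * (1 + l) := by
  have hβ := hp.pos
  have hp0 := hp.symm.pos
  have h1 := Real.young_inequality_of_nonneg (a := w * (p / 2) ^ (1 / p))
    (b := p * K * (p / 2) ^ (-(1 / p))) (by positivity) (by positivity) hp.symm
  have h2 : (w * (p / 2) ^ (1 / p)) ^ p = w ^ p * (p / 2) := by
    rw [Real.mul_rpow hw (by positivity), rpow_one_div_rpow (by positivity) hp0]
  have h3 : w * (p / 2) ^ (1 / p) * (p * K * (p / 2) ^ (-(1 / p))) = p * K * w := by
    rw [Real.rpow_neg (by positivity)]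
    field_simp
  have h4 : w ^ p * (p / 2) / p = w ^ p / 2 := by field_simp
  rw [h2, h3, h4] at h1
  set Y := (p * K * (p / 2) ^ (-(1 / p))) ^ β / β with hY
  have hY0 : 0 ≤ Y := by positivity
  rw [massConst, ← hY]
  have h5 : 0 ≤ Y * l := by positivity
  have h6 : 0 ≤ p * K * l := by positivity
  nlinarith

/-- With Y = T + K, n ≥ Y - (l + K) makes n^{1/β} at least Y^{1/β}(1 - (l + K)/Y), while Bernoulli
gives (1 - δ^p)^{1/p} ≤ 1 - δ^p/p. The deficit of order δ^p Y^{1/β} must be paid by Kδ and l + K; in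
terms of w = δ Y^{1/p} this is w^p ≤ pKw + p(l + K). -/
theorem mass_le (hp : β.HolderConjugate p) {K T δ n l : ℝ} (hK : 1 ≤ K) (hT : 0 ≤ T)
    (hn : 0 ≤ n) (hδ : 0 ≤ δ) (hδ1 : δ ≤ 1) (hl : 0 ≤ l) (hTn : T ≤ n + l)
    (h : n ^ (1 / β) ≤ K * δ + (1 - δ ^ p) ^ (1 / p) * (T + K) ^ (1 / β)) :
    δ ^ p * (T + K) ≤ massConst β p K * (1 + l) := by
  have hβ := hp.pos
  have hp0 := hp.symm.pos
  set Y := T + K with hY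
  have hY0 : 0 < Y := by linarith
  have hδp : δ ^ p ≤ 1 := Real.rpow_le_one hδ hδ1 hp.symm.nonneg
  have hδp0 : 0 ≤ δ ^ p := by positivity
  have h1 : (1 - δ ^ p) ^ (1 / p) ≤ 1 - δ ^ p / p := by
    have := rpow_one_add_le_one_add_mul_self (s := -δ ^ p) (by linarith)
      hp.symm.one_div_nonneg (by rw [div_le_one hp0]; exact hp.symm.lt.le)
    calc (1 - δ ^ p) ^ (1 / p) = (1 + -δ ^ p) ^ (1 / p) := by rw [sub_eq_add_neg]
      _ ≤ _ := this
      _ = _ := by ring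
  have h2 : Y ^ (1 / β) * (1 - (l + K) / Y) ≤ n ^ (1 / β) := by
    have e : n ^ (1 / β) = Y ^ (1 / β) * (n / Y) ^ (1 / β) := by
      rw [← Real.mul_rpow hY0.le (by positivity)]
      congr 1
      field_simp
    rw [e]
    refine mul_le_mul_of_nonneg_left ?_ (by positivity)
    have e2 : 1 - (l + K) / Y ≤ n / Y := by
      rw [sub_le_iff_le_add, ← add_div, le_div_iff₀ hY0]; linarith
    rcases le_total (n / Y) 1 with h3 | h3
    · refine e2.trans ?_
      have := Real.rpow_le_rpow_of_exponent_ge' (by positivity : 0 ≤ n / Y) h3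
        hp.one_div_nonneg (by rw [div_le_one hβ]; exact hp.lt.le)
      rwa [Real.rpow_one] at this
    · have e3 : 0 ≤ (l + K) / Y := by positivity
      linarith [Real.one_le_rpow h3 hp.one_div_nonneg]
  have hYY : Y ^ (1 / β) * Y ^ (1 / p) = Y := by
    rw [← Real.rpow_add hY0, one_div, one_div, hp.inv_add_inv_eq_one, Real.rpow_one]
  have h3 : δ ^ p / p * Y ^ (1 / β) ≤ K * δ + (l + K) / Y * Y ^ (1 / β) := by
    have := mul_le_mul_of_nonneg_right h1 (by positivity : 0 ≤ Y ^ (1 / β))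
    nlinarith
  have h4 : δ ^ p * Y ≤ p * K * (δ * Y ^ (1 / p)) + p * (l + K) := by
    have h5 := mul_le_mul_of_nonneg_right h3 (by positivity : 0 ≤ p * Y ^ (1 / p))
    calc δ ^ p * Y = δ ^ p / p * Y ^ (1 / β) * (p * Y ^ (1 / p)) := by
          nth_rewrite 1 [← hYY]; field_simp
      _ ≤ _ := h5
      _ = p * K * (δ * Y ^ (1 / p)) + p * ((l + K) / Y) * (Y ^ (1 / β) * Y ^ (1 / p)) := by ring
      _ = _ := by rw [hYY]; field_simp
  have h6 : (δ * Y ^ (1 / p)) ^ p = δ ^ p * Y := by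
    rw [Real.mul_rpow hδ (by positivity), rpow_one_div_rpow hY0.le hp0]
  rw [← h6] at h4 ⊢
  exact rpow_le_of_rpow_le_linear hp (by linarith) (by positivity) hl h4

/-- Levels beyond this multiple of `1 + l` lie in the regime where the two-scale estimate gives a
gap bound. -/
noncomputable def gapThreshold (β p K : ℝ) : ℝ :=
  massConst β p K * (2 * K ^ β) ^ (1 / (β - 1))

/-- The constant in the bound of the gap between two levels. -/
noncomputable def gapConst (β p K : ℝ) : ℝ :=
  2 * (1 + K + 2 * gapThreshold β p K * Real.exp (β - 1))

theorem gapThreshold_pos (hp : β.HolderConjugate p) {K : ℝ} (hK : 1 ≤ K) :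
    0 < gapThreshold β p K := by
  have := massConst_pos hp (by linarith : 0 ≤ K)
  unfold gapThreshold
  positivity

theorem one_sub_rpow_neg_le {q θ : ℝ} (hq : 0 ≤ q) (hθ : 0 ≤ θ) (hθ2 : θ ≤ 1 / 2) :
    (1 - θ) ^ (-q) ≤ 1 + 2 * θ * Real.exp q := by
  have h1 : (1 - θ)⁻¹ ≤ 1 + 2 * θ := by
    rw [inv_le_iff_one_le_mul₀ (by linarith)]; nlinarith
  have h2 : 1 + 2 * θ ≤ Real.exp (2 * θ) := by linarith [Real.add_one_le_exp (2 * θ)]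
  have h3 := convexOn_exp.2 (mem_univ (0 : ℝ)) (mem_univ q) (by linarith : 0 ≤ 1 - 2 * θ)
    (by linarith : 0 ≤ 2 * θ) (by ring)
  simp only [smul_eq_mul, mul_zero, zero_add, Real.exp_zero, mul_one] at h3
  calc (1 - θ) ^ (-q) = ((1 - θ)⁻¹) ^ q := by
        rw [Real.rpow_neg (by linarith), Real.inv_rpow (by linarith)]
    _ ≤ Real.exp (2 * θ) ^ q :=
        Real.rpow_le_rpow (by rw [inv_nonneg]; linarith) (h1.trans h2) hq
    _ = Real.exp (2 * θ * q) := by rw [← Real.exp_mul]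
    _ ≤ _ := h3
    _ ≤ _ := by linarith

/-- Small mass makes the contribution of the gap Q = 1 + T' - T to n at most Q/2. Then T' ≤ n + l
bounds T' - T by Q/2 + O(1 + l), and the half is absorbed. -/
theorem gap_le (hp : β.HolderConjugate p) {K T T' δ n l : ℝ} (hK : 1 ≤ K) (hT : 0 ≤ T)
    (hTT : T ≤ T') (hn : 0 ≤ n) (hδ : 0 ≤ δ) (hδ1 : δ ≤ 1) (hl : 0 ≤ l) (hTn : T' ≤ n + l)
    (hmass : δ ^ p * (T + K) ≤ massConst β p K * (1 + l))
    (hbig : 2 * gapThreshold β p K * (1 + l) ≤ T + K)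
    (h : n ^ (1 / β) ≤ K * δ * (1 + T' - T) ^ (1 / β) +
      (1 - δ ^ p) ^ (1 / p) * (T + K) ^ (1 / β)) :
    T' - T ≤ gapConst β p K * (1 + l) := by
  have hβ := hp.pos
  have hβ1 : 0 < β - 1 := by linarith [hp.lt]
  have hp0 := hp.symm.pos
  have hδp : δ ^ p ≤ 1 := Real.rpow_le_one hδ hδ1 hp.symm.nonneg
  have hδp0 : 0 ≤ δ ^ p := by positivity
  have hC4 := massConst_pos hp (by linarith : 0 ≤ K)
  have hC6 := gapThreshold_pos hp hK
  set Y := T + K with hY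
  set Q := 1 + T' - T with hQ
  set C6 := gapThreshold β p K with hC6d
  have hY0 : 0 < Y := by linarith
  have hQ0 : 0 < Q := by linarith
  -- Hölder weight: θ exceeds the bound for δ^p by the factor (2K^β)^{1/(β-1)}, so that K^β
  -- (δ^p/θ)^{β-1} ≤ 1/2, yet Yθ = O(1 + l), so Y(1 - θ)^{-(β-1)} is Y + O(1 + l). `hbig` is what
  -- gives θ ≤ 1/2.
  set θ := C6 * (1 + l) / Y with hθ
  have hθ0 : 0 < θ := by positivity
  have hθ2 : θ ≤ 1 / 2 := by
    rw [hθ, div_le_iff₀ hY0]; linarith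
  have hβp : β * (1 / p) = β - 1 := by
    have := hp.sub_one_mul_conj
    field_simp
    linarith
  have h1 : n ^ (1 / β) ≤ θ ^ (1 / p) * (K * δ * Q ^ (1 / β) * θ ^ (-(1 / p))) +
      (1 - θ) ^ (1 / p) * (Y ^ (1 / β) * (1 - θ) ^ (-(1 / p))) := by
    have e1 : θ ^ (1 / p) * (K * δ * Q ^ (1 / β) * θ ^ (-(1 / p))) = K * δ * Q ^ (1 / β) := by
      rw [Real.rpow_neg hθ0.le]; field_simp
    have e2 : (1 - θ) ^ (1 / p) * (Y ^ (1 / β) * (1 - θ) ^ (-(1 / p))) = Y ^ (1 / β) := by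
      have : 0 < 1 - θ := by linarith
      rw [Real.rpow_neg this.le]; field_simp
    rw [e1, e2]
    refine h.trans (add_le_add_right (mul_le_of_le_one_left (by positivity) ?_) _)
    exact Real.rpow_le_one (by linarith) (by linarith) hp.symm.one_div_nonneg
  have hθ' : 0 < 1 - θ := by linarith
  have h2 := two_term_holder hp (x₁ := θ ^ (1 / p)) (x₂ := (1 - θ) ^ (1 / p))
    (y₁ := K * δ * Q ^ (1 / β) * θ ^ (-(1 / p))) (y₂ := Y ^ (1 / β) * (1 - θ) ^ (-(1 / p)))
    (by positivity) (by positivity) (by positivity) (by positivity)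
    (by rw [rpow_one_div_rpow hθ0.le hp0, rpow_one_div_rpow hθ'.le hp0]; linarith)
  have h3 : n ≤ (K * δ * Q ^ (1 / β) * θ ^ (-(1 / p))) ^ β +
      (Y ^ (1 / β) * (1 - θ) ^ (-(1 / p))) ^ β := by
    refine le_trans ?_ h2
    have := Real.rpow_le_rpow (by positivity) h1 hβ.le
    rwa [rpow_one_div_rpow hn hβ] at this
  have e3 : ∀ a : ℝ, 0 < a → (a ^ (-(1 / p))) ^ β = a ^ (-(β - 1)) := fun a ha => by
    rw [← Real.rpow_mul ha.le]
    congr 1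
    rw [← hβp]; ring
  have h4 : (Y ^ (1 / β) * (1 - θ) ^ (-(1 / p))) ^ β ≤ Y + 2 * C6 * Real.exp (β - 1) * (1 + l) := by
    rw [Real.mul_rpow (by positivity) (by positivity), rpow_one_div_rpow hY0.le hβ, e3 _ hθ']
    calc Y * (1 - θ) ^ (-(β - 1)) ≤ Y * (1 + 2 * θ * Real.exp (β - 1)) :=
          mul_le_mul_of_nonneg_left (one_sub_rpow_neg_le hβ1.le hθ0.le hθ2) hY0.le
      _ = _ := by rw [hθ]; field_simp
  have h5 : (K * δ * Q ^ (1 / β) * θ ^ (-(1 / p))) ^ β ≤ Q / 2 := by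
    have e4 : δ ^ β = (δ ^ p) ^ (β - 1) := by
      rw [← Real.rpow_mul hδ]; congr 1
      have := hp.sub_one_mul_conj
      linarith
    have e5 : δ ^ p ≤ massConst β p K * (1 + l) / Y := by rwa [le_div_iff₀ hY0]
    have hK0 : 0 < K := by linarith
    rw [Real.mul_rpow (by positivity) (by positivity), Real.mul_rpow (by positivity) (by positivity),
      Real.mul_rpow (by positivity) (by positivity), rpow_one_div_rpow hQ0.le hβ, e3 _ hθ0, e4,
      Real.rpow_neg hθ0.le, ← Real.inv_rpow hθ0.le]
    have e6 : δ ^ p * θ⁻¹ ≤ ((2 * K ^ β) ^ (1 / (β - 1)))⁻¹ := by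
      calc δ ^ p * θ⁻¹ ≤ massConst β p K * (1 + l) / Y * θ⁻¹ :=
            mul_le_mul_of_nonneg_right e5 (by positivity)
        _ = _ := by rw [hθ, hC6d, gapThreshold]; field_simp
    have e7 : (δ ^ p) ^ (β - 1) * θ⁻¹ ^ (β - 1) ≤ (2 * K ^ β)⁻¹ := by
      rw [← Real.mul_rpow hδp0 (by positivity)]
      refine (Real.rpow_le_rpow (by positivity) e6 hβ1.le).trans (le_of_eq ?_)
      rw [Real.inv_rpow (by positivity), rpow_one_div_rpow (by positivity) hβ1]
    calc K ^ β * (δ ^ p) ^ (β - 1) * Q * θ⁻¹ ^ (β - 1)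
        = K ^ β * Q * ((δ ^ p) ^ (β - 1) * θ⁻¹ ^ (β - 1)) := by ring
      _ ≤ K ^ β * Q * (2 * K ^ β)⁻¹ := mul_le_mul_of_nonneg_left e7 (by positivity)
      _ = Q / 2 := by
        have : 0 < K ^ β := by positivity
        field_simp
  have hKl : 0 ≤ K * l := by nlinarith
  have hg : gapConst β p K * (1 + l) =
      2 * (1 + K) * (1 + l) + 2 * (2 * C6 * Real.exp (β - 1) * (1 + l)) := by
    rw [gapConst]; ring
  rw [hg]
  nlinarith

/-- The constant counting the levels close to the critical line. -/
noncomputable def countConst (β p K : ℝ) : ℝ :=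
  2 * gapThreshold β p K + gapConst β p K + 1 + K + K ^ β

/-- The hypotheses of the Adams–Garsia argument: a nondecreasing family of scales `T n`, with
masses `δ n`, subject to the two-scale estimate. -/
structure ScaleFamily (β p K : ℝ) (I : Set ℕ) (T δ : ℕ → ℝ) : Prop where
  nonneg : ∀ n ∈ I, 0 ≤ T n
  mono : ∀ m ∈ I, ∀ n ∈ I, m ≤ n → T m ≤ T n
  mass_nonneg : ∀ n ∈ I, 0 ≤ δ n
  mass_le_one : ∀ n ∈ I, δ n ≤ 1
  two_scale : ∀ m ∈ I, ∀ n ∈ I, m ≤ n → (n : ℝ) ^ (1 / β) ≤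
    K * δ m * (1 + T n - T m) ^ (1 / β) + (1 - δ m ^ p) ^ (1 / p) * (T m + K) ^ (1 / β)

namespace ScaleFamily

variable {K : ℝ} {I : Set ℕ} {T δ : ℕ → ℝ}

theorem one_scale (hI : ScaleFamily β p K I T δ) {n : ℕ} (hn : n ∈ I) :
    (n : ℝ) ^ (1 / β) ≤ K * δ n + (1 - δ n ^ p) ^ (1 / p) * (T n + K) ^ (1 / β) := by
  simpa using hI.two_scale n hn n hn le_rfl

theorem level_le (hI : ScaleFamily β p K I T δ) (hp : β.HolderConjugate p) (hK : 0 ≤ K) {n : ℕ}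
    (hn : n ∈ I) : (n : ℝ) ≤ T n + K + K ^ β :=
  level_le_of_one_scale hp hK (hI.nonneg n hn) n.cast_nonneg (hI.mass_nonneg n hn)
    (hI.mass_le_one n hn) (hI.one_scale hn)

/-- Near-critical levels below the threshold are bounded by `level_le`. Beyond it, let a be the
least one: by `gap_le`, any later n has T n - T a = O(1 + l), and then n ≤ T n + K + K^β and T a ≤ a
+ l give n - a = O(1 + l). -/
theorem exists_near_critical (hI : ScaleFamily β p K I T δ) (hp : β.HolderConjugate p)
    (hK : 1 ≤ K) (l : ℕ) :
    ∃ a : ℕ, ∀ n ∈ I, T n ≤ n + l →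
      n ≤ ⌊countConst β p K * (1 + l)⌋₊ ∨ a ≤ n ∧ n ≤ a + ⌊countConst β p K * (1 + l)⌋₊ := by
  have hC6 := gapThreshold_pos hp hK
  have hC7 : 0 ≤ gapConst β p K := by unfold gapConst; positivity
  have hKβ : 0 ≤ K ^ β := by positivity
  have hl : (0 : ℝ) ≤ l := l.cast_nonneg
  have hcc : countConst β p K * (1 + l) = 2 * gapThreshold β p K * (1 + l) +
      gapConst β p K * (1 + l) + (1 + l) + (K + K ^ β) + (K + K ^ β) * l := by
    unfold countConst; ring
  have hr1 : 0 ≤ 2 * gapThreshold β p K * (1 + l) := by positivity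
  have hr2 : 0 ≤ gapConst β p K * (1 + l) := by positivity
  have hr3 : 0 ≤ (K + K ^ β) * l := by positivity
  have hsmall : ∀ n ∈ I, T n + K < 2 * gapThreshold β p K * (1 + l) →
      n ≤ ⌊countConst β p K * (1 + l)⌋₊ := fun n hn h => by
    refine Nat.le_floor ?_
    have := hI.level_le hp (by linarith) hn
    linarith
  by_cases hex : ∃ n, n ∈ I ∧ T n ≤ n + l ∧ 2 * gapThreshold β p K * (1 + l) ≤ T n + K
  · classical
    obtain ⟨haI, hal, habig⟩ := Nat.find_spec hex
    refine ⟨Nat.find hex, fun n hn hnl => ?_⟩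
    rcases lt_or_ge (T n + K) (2 * gapThreshold β p K * (1 + l)) with h | h
    · exact Or.inl (hsmall n hn h)
    · have han : Nat.find hex ≤ n := Nat.find_min' hex ⟨hn, hnl, h⟩
      refine Or.inr ⟨han, ?_⟩
      set a := Nat.find hex with ha
      have hmass := mass_le hp hK (hI.nonneg a haI) a.cast_nonneg (hI.mass_nonneg a haI)
        (hI.mass_le_one a haI) hl hal (hI.one_scale haI)
      have hgap := gap_le hp hK (hI.nonneg a haI) (hI.mono a haI n hn han) n.cast_nonneg
        (hI.mass_nonneg a haI) (hI.mass_le_one a haI) hl hnl hmass habig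
        (hI.two_scale a haI n hn han)
      have hlev := hI.level_le hp (by linarith) hn
      have : n - a ≤ ⌊countConst β p K * (1 + l)⌋₊ := by
        refine Nat.le_floor ?_
        rw [Nat.cast_sub han]
        linarith
      omega
  · refine ⟨0, fun n hn hnl => Or.inl (hsmall n hn ?_)⟩
    by_contra! h
    exact hex ⟨n, hn, hnl, h⟩

theorem tsum_near_critical_le (hI : ScaleFamily β p K I T δ) (hp : β.HolderConjugate p)
    (hK : 1 ≤ K) (l : ℕ) :
    ∑' n, {n | n ∈ I ∧ T n ≤ n + l}.indicator (fun _ => (1 : ℝ≥0∞)) n ≤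
      ENNReal.ofReal (2 * (countConst β p K + 1) * (1 + l)) := by
  have hC6 := gapThreshold_pos hp hK
  have hcc : 0 ≤ countConst β p K := by unfold countConst gapConst; positivity
  obtain ⟨a, ha⟩ := hI.exists_near_critical hp hK l
  set L := ⌊countConst β p K * (1 + l)⌋₊ with hL
  set S : Finset ℕ := Finset.Iic L ∪ Finset.Icc a (a + L) with hS
  have hle : ∀ n, {n | n ∈ I ∧ T n ≤ n + l}.indicator (fun _ => (1 : ℝ≥0∞)) n ≤
      (S : Set ℕ).indicator (fun _ => (1 : ℝ≥0∞)) n := by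
    refine fun n => indicator_le_indicator_of_subset (fun n hn => ?_) (fun _ => zero_le) n
    simpa [hS] using ha n hn.1 hn.2
  have hcard : S.card ≤ 2 * (L + 1) := by
    refine (Finset.card_union_le _ _).trans ?_
    rw [Nat.card_Iic, Nat.card_Icc]
    omega
  have hLr : (L : ℝ) ≤ countConst β p K * (1 + l) := Nat.floor_le (by positivity)
  calc ∑' n, {n | n ∈ I ∧ T n ≤ n + l}.indicator (fun _ => (1 : ℝ≥0∞)) n
      ≤ ∑' n, (S : Set ℕ).indicator (fun _ => (1 : ℝ≥0∞)) n := ENNReal.tsum_le_tsum hle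
    _ = S.card := by
        rw [← tsum_subtype (S : Set ℕ) (fun _ => (1 : ℝ≥0∞)),
          Finset.tsum_subtype' S (fun _ => (1 : ℝ≥0∞))]
        simp
    _ ≤ ENNReal.ofReal (2 * (countConst β p K + 1) * (1 + l)) := by
        rw [← ENNReal.ofReal_natCast]
        refine ENNReal.ofReal_le_ofReal ?_
        have : (S.card : ℝ) ≤ 2 * (L + 1) := by exact_mod_cast hcard
        have hl : (0 : ℝ) ≤ l := l.cast_nonneg
        nlinarith

end ScaleFamily

/-- The constant in the exponential sum over the levels. -/
noncomputable def expSumConst (β p σ K : ℝ) : ℝ :=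
  ∑' l : ℕ, Real.exp (σ * (K + K ^ β + 1 - l)) * (2 * (countConst β p K + 1) * (1 + l))

theorem summable_expSumConst {σ : ℝ} (hσ : 0 < σ) (K : ℝ) :
    Summable fun l : ℕ =>
      Real.exp (σ * (K + K ^ β + 1 - l)) * (2 * (countConst β p K + 1) * (1 + l)) := by
  have hr : ‖Real.exp (-σ)‖ < 1 := by
    rw [Real.norm_of_nonneg (Real.exp_pos _).le, Real.exp_lt_one_iff]; linarith
  have h0 := summable_geometric_of_norm_lt_one hr
  have h1 := summable_pow_mul_geometric_of_norm_lt_one 1 hr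
  refine ((h0.add h1).mul_left
    (Real.exp (σ * (K + K ^ β + 1)) * (2 * (countConst β p K + 1)))).congr fun l => ?_
  have : Real.exp (σ * (K + K ^ β + 1 - l)) =
      Real.exp (σ * (K + K ^ β + 1)) * Real.exp (-σ) ^ l := by
    rw [← Real.exp_nat_mul, ← Real.exp_add]; congr 1; ring
  rw [this]
  ring

/-- Sort the levels by l = ⌈T n - n⌉₊: there are O(1 + l) of them, each contributing O(e^{-σ l}). -/
theorem ScaleFamily.tsum_exp_le {K σ : ℝ} {I : Set ℕ} {T δ : ℕ → ℝ}
    (hI : ScaleFamily β p K I T δ) (hp : β.HolderConjugate p) (hK : 1 ≤ K) (hσ : 0 < σ) :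
    ∑' n, I.indicator (fun n => ENNReal.ofReal (Real.exp (σ * (n - T n)))) n ≤
      ENNReal.ofReal (expSumConst β p σ K) := by
  have hC6 := gapThreshold_pos hp hK
  have hcc : 0 ≤ countConst β p K := by unfold countConst gapConst; positivity
  have hKβ : 0 ≤ K ^ β := by positivity
  set S : ℕ → Set ℕ := fun l => {n | n ∈ I ∧ T n ≤ n + l} with hS
  have hpt : ∀ n, I.indicator (fun n => ENNReal.ofReal (Real.exp (σ * (n - T n)))) n ≤
      ∑' l : ℕ, ENNReal.ofReal (Real.exp (σ * (K + K ^ β + 1 - l))) *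
        (S l).indicator (fun _ => (1 : ℝ≥0∞)) n := by
    intro n
    by_cases hn : n ∈ I
    swap
    · simp [hn]
    rw [indicator_of_mem hn]
    refine le_trans ?_ (ENNReal.le_tsum ⌈T n - n⌉₊)
    have hmem : n ∈ S ⌈T n - n⌉₊ := ⟨hn, by linarith [Nat.le_ceil (T n - n)]⟩
    rw [indicator_of_mem hmem, mul_one]
    refine ENNReal.ofReal_le_ofReal (Real.exp_le_exp.2 (mul_le_mul_of_nonneg_left ?_ hσ.le))
    rcases le_or_gt 0 (T n - n) with h | h
    · linarith [Nat.ceil_lt_add_one h]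
    -- All levels with T n < n fall into l = 0; `level_le` still bounds n - T n by K + K^β.
    · rw [Nat.ceil_eq_zero.2 h.le]
      have := hI.level_le hp (by linarith) hn
      push_cast
      linarith
  calc _ ≤ ∑' n, ∑' l : ℕ, ENNReal.ofReal (Real.exp (σ * (K + K ^ β + 1 - l))) *
        (S l).indicator (fun _ => (1 : ℝ≥0∞)) n := ENNReal.tsum_le_tsum hpt
    _ = ∑' l : ℕ, ENNReal.ofReal (Real.exp (σ * (K + K ^ β + 1 - l))) *
        ∑' n, (S l).indicator (fun _ => (1 : ℝ≥0∞)) n := by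
      rw [ENNReal.tsum_comm]
      simp_rw [ENNReal.tsum_mul_left]
    _ ≤ ∑' l : ℕ, ENNReal.ofReal (Real.exp (σ * (K + K ^ β + 1 - l)) *
        (2 * (countConst β p K + 1) * (1 + l))) := by
      refine ENNReal.tsum_le_tsum fun l => ?_
      rw [ENNReal.ofReal_mul (Real.exp_pos _).le]
      exact mul_le_mul_right (hI.tsum_near_critical_le hp hK l) _
    _ = _ := by
      rw [expSumConst, ENNReal.ofReal_tsum_of_nonneg (fun l => by positivity)
        (summable_expSumConst hσ K)]

end Garsia

end AdamsIneq

/-! ### From the counting argument to the exponential integral -/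

namespace AdamsIneq

variable {M N : Type*} [MeasurableSpace M] [MeasurableSpace N] {μ : Measure M} {ν : Measure N}

/-- The constant of the normalized two-scale estimate. -/
noncomputable def normConst (β p σ A B c K : ℝ) : ℝ :=
  max 1 (max K (scaleConst β p σ B c / A ^ (1 / β)))

/-- The constant of the exponential inequality on sets of finite measure. -/
noncomputable def adamsConst (β p σ A B c K : ℝ) : ℝ :=
  1 + Real.exp (σ * (normConst β p σ A B c K + normConst β p σ A B c K ^ β + 2)) /
      (Real.exp σ - 1) +
    Real.exp σ * expSumConst β p σ (normConst β p σ A B c K)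

variable {β p σ A B c K J τ : ℝ} {G : N → M → ℝ≥0∞}

theorem expSumConst_nonneg (hp : β.HolderConjugate p) {K : ℝ} (hK : 1 ≤ K) :
    0 ≤ expSumConst β p σ K := by
  have := gapThreshold_pos hp hK
  refine tsum_nonneg fun l => ?_
  unfold countConst gapConst
  positivity

theorem one_le_normConst : 1 ≤ normConst β p σ A B c K := le_max_left _ _

theorem adamsConst_pos (hp : β.HolderConjugate p) (hσ : 0 < σ) :
    0 < adamsConst β p σ A B c K := by
  have h1 := expSumConst_nonneg (σ := σ) hp (one_le_normConst (β := β) (p := p) (σ := σ) (A := A)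
    (B := B) (c := c) (K := K))
  have h2 : 0 < Real.exp σ - 1 := by linarith [Real.add_one_le_exp σ]
  unfold adamsConst
  positivity

theorem tsum_exp_le_of_le (hσ : 0 < σ) {b : ℝ} (hb : 0 ≤ b) :
    ∑' n : ℕ, {n : ℕ | (n : ℝ) ≤ b}.indicator
        (fun n : ℕ => ENNReal.ofReal (Real.exp (σ * (n + 1)))) n ≤
      ENNReal.ofReal (Real.exp (σ * (b + 2)) / (Real.exp σ - 1)) := by
  have h2 : 0 < Real.exp σ - 1 := by linarith [Real.add_one_le_exp σ]
  set S := Finset.range (⌊b⌋₊ + 1) with hS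
  have hset : {n : ℕ | (n : ℝ) ≤ b} = (S : Set ℕ) := by
    ext n
    simp [hS, Nat.le_floor_iff hb]
  rw [hset, ← tsum_subtype (S : Set ℕ) fun n : ℕ => ENNReal.ofReal (Real.exp (σ * (n + 1))),
    Finset.tsum_subtype' S fun n : ℕ => ENNReal.ofReal (Real.exp (σ * (n + 1))),
    ← ENNReal.ofReal_sum_of_nonneg fun n _ => (Real.exp_pos _).le]
  refine ENNReal.ofReal_le_ofReal ?_
  have h1 : ∀ n : ℕ, Real.exp (σ * (n + 1)) = Real.exp σ * Real.exp σ ^ n := fun n => by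
    rw [← Real.exp_nat_mul, ← Real.exp_add]; congr 1; ring
  simp_rw [h1]
  rw [← Finset.mul_sum, hS, geom_sum_eq (by linarith), mul_div_assoc']
  refine div_le_div_of_nonneg_right ?_ h2.le
  calc Real.exp σ * (Real.exp σ ^ (⌊b⌋₊ + 1) - 1) ≤ Real.exp σ * Real.exp σ ^ (⌊b⌋₊ + 1) :=
        mul_le_mul_of_nonneg_left (by linarith) (Real.exp_pos _).le
    _ = Real.exp (σ * (⌊b⌋₊ + 2)) := by
        rw [← Real.exp_nat_mul, ← Real.exp_add]; congr 1; push_cast; ring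
    _ ≤ _ := by
        refine Real.exp_le_exp.2 (mul_le_mul_of_nonneg_left ?_ hσ.le)
        linarith [Nat.floor_le hb]

/-- The single term n = ⌈z⌉ - 1 already dominates; the summand 1 covers z = 0, where the sum is
empty. -/
theorem exp_le_one_add_tsum (hσ : 0 < σ) {z : ℝ} (hz : 0 ≤ z) :
    ENNReal.ofReal (Real.exp (σ * z)) ≤ 1 + ∑' n : ℕ,
      {n : ℕ | (n : ℝ) < z}.indicator (fun n => ENNReal.ofReal (Real.exp (σ * (n + 1)))) n := by
  rcases hz.eq_or_lt with rfl | hz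
  · simp
  obtain ⟨n, hn⟩ := Nat.exists_eq_succ_of_ne_zero (Nat.ceil_pos.2 hz).ne'
  have hlt : (n : ℝ) < z := Nat.lt_ceil.1 (by omega)
  have hle : z ≤ n + 1 := by
    have := Nat.le_ceil z
    rw [hn] at this
    simpa using this
  refine le_trans ?_ (le_add_left (ENNReal.le_tsum n))
  rw [indicator_of_mem (show n ∈ {n : ℕ | (n : ℝ) < z} from hlt)]
  exact ENNReal.ofReal_le_ofReal (Real.exp_le_exp.2 (mul_le_mul_of_nonneg_left hle hσ.le))

section Levels

variable {S : N → ℝ≥0∞} {E : Set N}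

/-- The part of `E` where `S ^ β / A` exceeds `n`. -/
def level {N : Type*} (S : N → ℝ≥0∞) (E : Set N) (β A : ℝ) (n : ℕ) : Set N :=
  E ∩ {x | ENNReal.ofReal (A * n) < S x ^ β}

/-- The scale `min τ (ν (level n) ^ (1 / σ))`. -/
noncomputable def levelScale (ν : Measure N) (S : N → ℝ≥0∞) (E : Set N) (β A σ τ : ℝ) (n : ℕ) : ℝ :=
  min τ ((ν (level S E β A n)).toReal ^ (1 / σ))

theorem measurableSet_level (hS : Measurable S) (hE : MeasurableSet E) (n : ℕ) :
    MeasurableSet (level S E β A n) :=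
  hE.inter (measurableSet_lt measurable_const (hS.pow_const β))

theorem level_antitone {N : Type*} {S : N → ℝ≥0∞} {E : Set N} (hA : 0 ≤ A) : Antitone (level S E β A) := fun m n hmn x hx =>
  ⟨hx.1, lt_of_le_of_lt (ENNReal.ofReal_le_ofReal (mul_le_mul_of_nonneg_left
    (by exact_mod_cast hmn) hA)) hx.2⟩

theorem measure_level_ne_top (hEt : ν E ≠ ∞) (n : ℕ) : ν (level S E β A n) ≠ ∞ :=
  ne_top_of_le_ne_top hEt (measure_mono inter_subset_left)

theorem levelScale_pos (hEt : ν E ≠ ∞) (hτ : 0 < τ) {n : ℕ} (hn : ν (level S E β A n) ≠ 0) :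
    0 < levelScale ν S E β A σ τ n :=
  lt_min hτ (Real.rpow_pos_of_pos (ENNReal.toReal_pos hn (measure_level_ne_top hEt n)) _)

theorem levelScale_antitone (hA : 0 ≤ A) (hσ : 0 < σ) (hEt : ν E ≠ ∞) :
    Antitone (levelScale ν S E β A σ τ) := fun m n hmn =>
  min_le_min le_rfl (Real.rpow_le_rpow ENNReal.toReal_nonneg (ENNReal.toReal_mono
    (measure_level_ne_top hEt m) (measure_mono (level_antitone hA hmn))) (by positivity))

theorem ofReal_levelScale_rpow_le (hσ : 0 < σ) (hτ : 0 < τ) (n : ℕ) :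
    ENNReal.ofReal (levelScale ν S E β A σ τ n ^ σ) ≤ ν (level S E β A n) := by
  refine ENNReal.ofReal_le_of_le_toReal ?_
  calc levelScale ν S E β A σ τ n ^ σ ≤ ((ν (level S E β A n)).toReal ^ (1 / σ)) ^ σ :=
        Real.rpow_le_rpow (le_min hτ.le (by positivity)) (min_le_right _ _) hσ.le
    _ = _ := rpow_one_div_rpow ENNReal.toReal_nonneg hσ

/-- The integral over `E` of the exponential in terms of the measures of the levels. -/
theorem setLIntegral_exp_le (hA : 0 < A) (hσ : 0 < σ) (hβ : 0 < β) (hS : Measurable S)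
    (hSt : ∀ᵐ x ∂ν, S x < ∞) (hE : MeasurableSet E) :
    ∫⁻ x in E, ENNReal.ofReal (Real.exp (σ / A * (S x).toReal ^ β)) ∂ν ≤
      ν E + ∑' n : ℕ, ENNReal.ofReal (Real.exp (σ * (n + 1))) * ν (level S E β A n) := by
  have hpt : ∀ᵐ x ∂ν, x ∈ E → ENNReal.ofReal (Real.exp (σ / A * (S x).toReal ^ β)) ≤
      1 + ∑' n : ℕ, (level S E β A n).indicator
        (fun _ => ENNReal.ofReal (Real.exp (σ * (n + 1)))) x := by
    filter_upwards [hSt] with x hx hxE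
    have h1 := exp_le_one_add_tsum hσ (z := (S x).toReal ^ β / A) (by positivity)
    have h2 : σ * ((S x).toReal ^ β / A) = σ / A * (S x).toReal ^ β := by ring
    rw [h2] at h1
    refine h1.trans (add_le_add_right (ENNReal.tsum_le_tsum fun n => ?_) _)
    by_cases hn : (n : ℝ) < (S x).toReal ^ β / A
    · have hmem : x ∈ level S E β A n := by
        refine ⟨hxE, ?_⟩
        rw [lt_div_iff₀ hA, mul_comm] at hn
        change ENNReal.ofReal (A * n) < S x ^ β
        rw [ENNReal.ofReal_lt_iff_lt_toReal (by positivity)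
          (ENNReal.rpow_ne_top_of_nonneg hβ.le hx.ne), ← ENNReal.toReal_rpow]
        exact hn
      rw [indicator_of_mem (show n ∈ {n : ℕ | (n : ℝ) < (S x).toReal ^ β / A} from hn),
        indicator_of_mem hmem]
    · rw [indicator_of_notMem (show n ∉ {n : ℕ | (n : ℝ) < (S x).toReal ^ β / A} from hn)]
      exact zero_le
  have hm : ∀ n : ℕ, Measurable ((level S E β A n).indicator
      (fun _ => ENNReal.ofReal (Real.exp (σ * (n + 1))))) := fun n =>
    measurable_const.indicator (measurableSet_level hS hE n)
  calc _ ≤ ∫⁻ x in E, (1 + ∑' n : ℕ, (level S E β A n).indicator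
        (fun _ => ENNReal.ofReal (Real.exp (σ * (n + 1)))) x) ∂ν :=
        lintegral_mono_ae ((ae_restrict_iff' hE).2 hpt)
    _ = ν E + ∑' n : ℕ, ∫⁻ x in E, (level S E β A n).indicator
        (fun _ => ENNReal.ofReal (Real.exp (σ * (n + 1)))) x ∂ν := by
        rw [lintegral_add_left measurable_const, lintegral_tsum fun n => (hm n).aemeasurable]
        simp
    _ ≤ _ := by
        refine add_le_add_right (ENNReal.tsum_le_tsum fun n => ?_) _
        refine (setLIntegral_le_lintegral _ _).trans (le_of_eq ?_)
        rw [lintegral_indicator_const (measurableSet_level hS hE n)]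

end Levels

theorem KernelBounds.measurable_potential [SFinite μ] (hG : KernelBounds μ ν G β σ A B c K J τ)
    {g : M → ℝ≥0∞} (hg : Measurable g) : Measurable fun x => ∫⁻ y, G x y * g y ∂μ := by
  have : Measurable (Function.uncurry fun x y => G x y * g y) :=
    hG.measurable.mul (hg.comp measurable_snd)
  exact this.lintegral_prod_right

/-- The levels of a potential form a family of scales satisfying the two-scale estimate. -/
theorem KernelBounds.exists_scaleFamily [SFinite μ] [SFinite ν]
    (hG : KernelBounds μ ν G β σ A B c K J τ) (hp : β.HolderConjugate p) (hσ : 0 < σ)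
    (hA : 0 < A) (hB : 0 < B) (hc : 0 < c) (hK : 0 ≤ K) (hJ : 0 ≤ J) (hτ : 0 < τ)
    {g : M → ℝ≥0∞} (hg : Measurable g) (hgp : ∫⁻ y, g y ^ p ∂μ ≤ 1) {E : Set N}
    (hE : MeasurableSet E) (hEt : ν E ≠ ∞) :
    ∃ δ : ℕ → ℝ, ScaleFamily β p (normConst β p σ A B c K)
      {n | ν (level (fun x => ∫⁻ y, G x y * g y ∂μ) E β A n) ≠ 0}
      (fun n => Real.log (τ / levelScale ν (fun x => ∫⁻ y, G x y * g y ∂μ) E β A σ τ n) + J) δ := by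
  have hβ := hp.pos
  set S : N → ℝ≥0∞ := fun x => ∫⁻ y, G x y * g y ∂μ with hS
  have hSm : Measurable S := hG.measurable_potential hg
  set F := level S E β A with hF
  set r := levelScale ν S E β A σ τ with hr
  set κ := normConst β p σ A B c K with hκ
  have hκ1 : 1 ≤ κ := one_le_normConst
  have hκ2 : K ≤ κ := (le_max_left _ _).trans (le_max_right _ _)
  have hκ3 : scaleConst β p σ B c / A ^ (1 / β) ≤ κ := (le_max_right _ _).trans (le_max_right _ _)
  have hrτ : ∀ n, r n ≤ τ := fun n => min_le_left _ _
  have hrpos : ∀ n, ν (F n) ≠ 0 → 0 < r n := fun n hn => levelScale_pos hEt hτ hn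
  have hlog : ∀ n, ν (F n) ≠ 0 → 0 ≤ Real.log (τ / r n) := fun n hn =>
    Real.log_nonneg ((one_le_div (hrpos n hn)).2 (hrτ n))
  -- Null levels lie outside the index set and get a dummy mass 0.
  have hex : ∀ n, ∃ δ : ℝ, ν (F n) ≠ 0 → 0 ≤ δ ∧ δ ≤ 1 ∧ ∀ r', 0 < r' → r' ≤ r n →
      ∀ F : Set N, MeasurableSet F → ν F ≠ ∞ → ENNReal.ofReal (r' ^ σ) ≤ ν F → ∀ l : ℝ≥0∞,
      (∀ x ∈ F, l ≤ ∫⁻ y, G x y * g y ∂μ) →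
      l ≤ ENNReal.ofReal (scaleConst β p σ B c * δ * (1 + Real.log (r n / r')) ^ (1 / β) +
        (1 - δ ^ p) ^ (1 / p) * (A * (Real.log (τ / r n) + J + K)) ^ (1 / β)) := by
    intro n
    by_cases hn : ν (F n) = 0
    · exact ⟨0, fun h => absurd hn h⟩
    · obtain ⟨δ, h⟩ := hG.exists_two_scale_bound hp hσ hA hB hc hK hJ hg hgp (hrpos n hn) (hrτ n)
      exact ⟨δ, fun _ => h⟩
  choose δ hδ using hex
  refine ⟨δ, fun n hn => add_nonneg (hlog n hn) hJ, fun m hm n hn hmn => ?_,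
    fun n hn => (hδ n hn).1, fun n hn => (hδ n hn).2.1, fun m hm n hn hmn => ?_⟩
  · have h1 := hrpos m hm
    have h2 := hrpos n hn
    have h3 : r n ≤ r m := levelScale_antitone hA.le hσ hEt hmn
    refine add_le_add_left (Real.log_le_log (by positivity) ?_) J
    exact div_le_div_of_nonneg_left hτ.le h2 h3
  · have h1 := hrpos m hm
    have h2 := hrpos n hn
    have h3 : r n ≤ r m := levelScale_antitone hA.le hσ hEt hmn
    obtain ⟨hδ0, hδ1, hδb⟩ := hδ m hm
    have hδp : δ m ^ p ≤ 1 := Real.rpow_le_one hδ0 hδ1 hp.symm.nonneg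
    have hδp' : 0 ≤ 1 - δ m ^ p := by linarith
    have hlm := hlog m hm
    have hlmn : 0 ≤ Real.log (r m / r n) := Real.log_nonneg ((one_le_div h2).2 h3)
    have hsc := scaleConst_pos (σ := σ) (B := B) hp hc
    -- The two-scale estimate from scale r m down to r n, on level n, where the potential is at
    -- least (A n)^{1/β}.
    have h4 := hδb (r n) h2 h3 (F n) (measurableSet_level hSm hE n) (measure_level_ne_top hEt n)
      (ofReal_levelScale_rpow_le hσ hτ n) (ENNReal.ofReal ((A * n) ^ (1 / β))) fun x hx => by
        have : ENNReal.ofReal (A * n) ≤ S x ^ β := hx.2.le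
        rw [← ENNReal.ofReal_rpow_of_nonneg (by positivity) hp.one_div_nonneg, one_div,
          ENNReal.rpow_inv_le_iff hβ]
        exact this
    rw [ENNReal.ofReal_le_ofReal_iff (by positivity), Real.mul_rpow hA.le (by positivity),
      Real.mul_rpow hA.le (by positivity)] at h4
    have hT : 1 + (Real.log (τ / r n) + J) - (Real.log (τ / r m) + J) =
        1 + Real.log (r m / r n) := by
      rw [Real.log_div hτ.ne' h2.ne', Real.log_div hτ.ne' h1.ne', Real.log_div h1.ne' h2.ne']
      ring
    have hA' : 0 < A ^ (1 / β) := by positivity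
    rw [hT]
    calc (n : ℝ) ^ (1 / β) = (A ^ (1 / β) * (n : ℝ) ^ (1 / β)) / A ^ (1 / β) := by field_simp
      _ ≤ (scaleConst β p σ B c * δ m * (1 + Real.log (r m / r n)) ^ (1 / β) +
          (1 - δ m ^ p) ^ (1 / p) * (A ^ (1 / β) * (Real.log (τ / r m) + J + K) ^ (1 / β))) /
            A ^ (1 / β) := div_le_div_of_nonneg_right h4 hA'.le
      _ = scaleConst β p σ B c / A ^ (1 / β) * (δ m * (1 + Real.log (r m / r n)) ^ (1 / β)) +
          (1 - δ m ^ p) ^ (1 / p) * (Real.log (τ / r m) + J + K) ^ (1 / β) := by field_simp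
      _ ≤ κ * (δ m * (1 + Real.log (r m / r n)) ^ (1 / β)) +
          (1 - δ m ^ p) ^ (1 / p) * (Real.log (τ / r m) + J + κ) ^ (1 / β) := by
        refine add_le_add (mul_le_mul_of_nonneg_right hκ3 (by positivity))
          (mul_le_mul_of_nonneg_left ?_ (by positivity))
        exact Real.rpow_le_rpow (by positivity) (by linarith) hp.one_div_nonneg
      _ = _ := by ring

/-- The Adams inequality on sets of finite measure for nonnegative kernels and densities. -/
theorem KernelBounds.setLIntegral_exp_le [SFinite μ] [SFinite ν]
    (hG : KernelBounds μ ν G β σ A B c K J τ) (hp : β.HolderConjugate p) (hσ : 0 < σ)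
    (hA : 0 < A) (hB : 0 < B) (hc : 0 < c) (hK : 0 ≤ K) (hJ : 0 ≤ J) (hτ : 0 < τ)
    {g : M → ℝ≥0∞} (hg : Measurable g) (hgp : ∫⁻ y, g y ^ p ∂μ ≤ 1) {E : Set N}
    (hE : MeasurableSet E) (hEt : ν E ≠ ∞) :
    ∫⁻ x in E, ENNReal.ofReal (Real.exp (σ / A * (∫⁻ y, G x y * g y ∂μ).toReal ^ β)) ∂ν ≤
      ENNReal.ofReal (adamsConst β p σ A B c K * Real.exp (σ * J)) *
        (ν E + ENNReal.ofReal (τ ^ σ)) := by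
  obtain ⟨δ, hfam⟩ := hG.exists_scaleFamily hp hσ hA hB hc hK hJ hτ hg hgp hE hEt
  set S : N → ℝ≥0∞ := fun x => ∫⁻ y, G x y * g y ∂μ with hS
  have hSm : Measurable S := hG.measurable_potential hg
  have hSt := hG.ae_lintegral_lt_top hp hσ hB hc hτ hg (hgp.trans_lt ENNReal.one_lt_top).ne
  set r := levelScale ν S E β A σ τ with hr
  set κ := normConst β p σ A B c K with hκ
  have hκ1 : 1 ≤ κ := one_le_normConst
  set T : ℕ → ℝ := fun n => Real.log (τ / r n) + J with hT
  set I : Set ℕ := {n | ν (level S E β A n) ≠ 0} with hI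
  set b := J + κ + κ ^ β with hb
  have hκβ : 0 ≤ κ ^ β := by positivity
  have hb0 : 0 ≤ b := by positivity
  -- Levels n ≤ b are bounded crudely by ν(E) and cost e^{σJ} up to a constant; levels beyond b go
  -- into the Adams–Garsia sum.
  have hterm : ∀ n : ℕ, ENNReal.ofReal (Real.exp (σ * (n + 1))) * ν (level S E β A n) ≤
      {n : ℕ | (n : ℝ) ≤ b}.indicator
        (fun n : ℕ => ENNReal.ofReal (Real.exp (σ * (n + 1)))) n * ν E +
      ENNReal.ofReal (τ ^ σ * Real.exp (σ * (J + 1))) *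
        I.indicator (fun n => ENNReal.ofReal (Real.exp (σ * (n - T n)))) n := by
    intro n
    by_cases hn : ν (level S E β A n) = 0
    · simp [hn]
    by_cases hnb : (n : ℝ) ≤ b
    · rw [indicator_of_mem (show n ∈ {n : ℕ | (n : ℝ) ≤ b} from hnb)]
      exact le_add_right (mul_le_mul_right (measure_mono inter_subset_left) _)
    · refine le_add_left ?_
      rw [indicator_of_mem (show n ∈ I from hn), ← ENNReal.ofReal_mul (by positivity)]
      have hlev := hfam.level_le hp (by linarith) (show n ∈ I from hn)
      have hrpos : 0 < r n := levelScale_pos hEt hτ hn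
      -- If r n = τ then T n = J, and `level_le` would force n ≤ b. So the minimum defining r n is
      -- attained by the measure.
      have hrlt : r n ≠ τ := by
        intro h
        have hTn : T n = J := by simp [hT, h, hτ.ne']
        exact hnb (by rw [hb, ← hTn]; exact hlev)
      have hreq : r n = (ν (level S E β A n)).toReal ^ (1 / σ) := by
        rcases min_choice τ ((ν (level S E β A n)).toReal ^ (1 / σ)) with h | h
        · exact absurd h hrlt
        · exact h
      have hν : ν (level S E β A n) = ENNReal.ofReal (r n ^ σ) := by
        rw [hreq, rpow_one_div_rpow ENNReal.toReal_nonneg hσ,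
          ENNReal.ofReal_toReal (measure_level_ne_top hEt n)]
      rw [hν, ← ENNReal.ofReal_mul (Real.exp_pos _).le]
      refine le_of_eq (congrArg _ ?_)
      rw [Real.rpow_def_of_pos hrpos, Real.rpow_def_of_pos hτ, ← Real.exp_add, ← Real.exp_add,
        ← Real.exp_add, hT]
      simp only
      rw [Real.log_div hτ.ne' hrpos.ne']
      congr 1
      ring
  have hσ1 : 0 < Real.exp σ - 1 := by linarith [Real.add_one_le_exp σ]
  have hes := expSumConst_nonneg (σ := σ) hp hκ1
  refine (AdamsIneq.setLIntegral_exp_le hA hσ hp.pos hSm hSt hE).trans ?_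
  have hsum := ENNReal.tsum_le_tsum hterm
  rw [ENNReal.tsum_add, ENNReal.tsum_mul_right, ENNReal.tsum_mul_left] at hsum
  set a := Real.exp (σ * (κ + κ ^ β + 2)) / (Real.exp σ - 1) with ha
  have ha0 : 0 ≤ a := by positivity
  have e1 : Real.exp (σ * (b + 2)) / (Real.exp σ - 1) = a * Real.exp (σ * J) := by
    rw [ha, div_mul_eq_mul_div, ← Real.exp_add, hb]
    congr 2
    ring
  have e2 : τ ^ σ * Real.exp (σ * (J + 1)) = Real.exp σ * Real.exp (σ * J) * τ ^ σ := by
    rw [← Real.exp_add, mul_comm]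
    congr 2
    ring
  have h1J : 1 ≤ Real.exp (σ * J) := Real.one_le_exp (by positivity)
  set X := expSumConst β p σ κ with hX
  have hC : adamsConst β p σ A B c K = 1 + a + Real.exp σ * X := rfl
  calc ν E + ∑' n : ℕ, ENNReal.ofReal (Real.exp (σ * (n + 1))) * ν (level S E β A n)
      ≤ ν E + (ENNReal.ofReal (a * Real.exp (σ * J)) * ν E +
        ENNReal.ofReal (Real.exp σ * Real.exp (σ * J) * τ ^ σ) * ENNReal.ofReal X) := by
        refine add_le_add_right (hsum.trans (add_le_add (mul_le_mul_left ?_ _) ?_)) _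
        · rw [← e1]; exact tsum_exp_le_of_le hσ hb0
        · rw [e2]; exact mul_le_mul_right (hfam.tsum_exp_le hp hκ1 hσ) _
    _ = ENNReal.ofReal (1 + a * Real.exp (σ * J)) * ν E +
        ENNReal.ofReal (Real.exp σ * Real.exp (σ * J) * X) * ENNReal.ofReal (τ ^ σ) := by
        rw [← ENNReal.ofReal_mul (by positivity), ← ENNReal.ofReal_mul (by positivity),
          ENNReal.ofReal_add zero_le_one (by positivity), ENNReal.ofReal_one, add_mul, one_mul,
          add_assoc]
        congr 3
        ring
    _ ≤ _ := by
        rw [mul_add, hC]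
        refine add_le_add (mul_le_mul_left (ENNReal.ofReal_le_ofReal ?_) _)
          (mul_le_mul_left (ENNReal.ofReal_le_ofReal ?_) _)
        · have : 0 ≤ Real.exp σ * X * Real.exp (σ * J) := by positivity
          nlinarith
        · have : 0 ≤ (1 + a) * Real.exp (σ * J) := by positivity
          nlinarith

/-! ### Regularized exponential on the whole space -/

section Regularized

theorem regExp_le_exp (m : ℕ) {z : ℝ} (hz : 0 ≤ z) : regExp m z ≤ Real.exp z := by
  unfold regExp
  have : 0 ≤ ∑ j ∈ Finset.range (m + 1), z ^ j / (j.factorial : ℝ) :=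
    Finset.sum_nonneg fun j _ => by positivity
  linarith

theorem regExp_le_pow_mul_exp (m : ℕ) {z : ℝ} (hz : 0 ≤ z) :
    regExp m z ≤ z ^ (m + 1) * Real.exp z := by
  have h := Complex.norm_exp_sub_sum_le_norm_mul_exp (z : ℂ) (m + 1)
  have h2 : Complex.exp z - ∑ j ∈ Finset.range (m + 1), (z : ℂ) ^ j / (j.factorial : ℂ) =
      ((regExp m z : ℝ) : ℂ) := by
    unfold regExp; push_cast; rfl
  rw [h2, Complex.norm_real, Complex.norm_real, Real.norm_of_nonneg hz] at h
  exact (Real.le_norm_self _).trans h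

theorem eLpNorm_ofReal_rpow (hp0 : 0 < p) (w : N → ℝ) :
    eLpNorm w (ENNReal.ofReal p) ν ^ p = ∫⁻ x, ‖w x‖ₑ ^ p ∂ν := by
  rw [eLpNorm_eq_lintegral_rpow_enorm_toReal (by simpa using hp0) ENNReal.ofReal_ne_top,
    ENNReal.toReal_ofReal hp0.le, ← ENNReal.rpow_mul, one_div_mul_cancel hp0.ne', ENNReal.rpow_one]

/-- An exponential inequality on sets of finite measure implies a regularized exponential
inequality on the whole space. -/
theorem lintegral_regExp_le (hp : β.HolderConjugate p) {a : ℝ} (ha : 0 < a) {w : N → ℝ}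
    (hw : Measurable w) {Q R : ℝ≥0∞} (hQ : Q ≠ 0)
    (h : ∀ E : Set N, MeasurableSet E → ν E < ∞ →
      ∫⁻ x in E, ENNReal.ofReal (Real.exp (a * |w x| ^ β)) ∂ν ≤ Q * (ν E + R)) :
    ∫⁻ x, ENNReal.ofReal (regExp ⌈p - 2⌉₊ (a * |w x| ^ β)) ∂ν ≤
      (ENNReal.ofReal (a ^ (⌈p - 2⌉₊ + 1) * Real.exp a) + Q) *
        (eLpNorm w (ENNReal.ofReal p) ν ^ p + R) := by
  have hβ := hp.pos
  have hp0 := hp.symm.pos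
  set m := ⌈p - 2⌉₊ with hm
  rw [eLpNorm_ofReal_rpow hp0]
  set L := ∫⁻ x, ‖w x‖ₑ ^ p ∂ν with hL
  rcases eq_or_ne L ∞ with hLt | hLt
  · rw [hLt, top_add, ENNReal.mul_top]
    · exact le_top
    · simp [hQ]
  -- By Chebyshev ν(E) is at most the p-th power norm, so the finite-measure inequality applies on
  -- E.
  set E : Set N := {x | 1 < |w x|} with hE
  have hEm : MeasurableSet E := measurableSet_lt measurable_const hw.abs
  have hEL : ν E ≤ L := by
    have h1 := mul_meas_ge_le_lintegral (μ := ν) (hw.enorm.pow_const p) 1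
    rw [one_mul] at h1
    refine (measure_mono fun x (hx : 1 < |w x|) => ?_).trans h1
    refine ENNReal.one_le_rpow ?_ hp0
    rw [← ofReal_norm, Real.norm_eq_abs, ENNReal.one_le_ofReal]
    exact hx.le
  have hE1 := h E hEm (hEL.trans_lt hLt.lt_top)
  have hE2 : ∫⁻ x in E, ENNReal.ofReal (regExp m (a * |w x| ^ β)) ∂ν ≤ Q * (L + R) :=
    (lintegral_mono fun x => ENNReal.ofReal_le_ofReal
      (regExp_le_exp m (by positivity))).trans (hE1.trans (by gcongr))
  have hE3 : ∫⁻ x in Eᶜ, ENNReal.ofReal (regExp m (a * |w x| ^ β)) ∂ν ≤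
      ENNReal.ofReal (a ^ (m + 1) * Real.exp a) * L := by
    have hpt : ∀ x ∈ Eᶜ, ENNReal.ofReal (regExp m (a * |w x| ^ β)) ≤
        ENNReal.ofReal (a ^ (m + 1) * Real.exp a) * ‖w x‖ₑ ^ p := by
      intro x hx
      have hx1 : |w x| ≤ 1 := not_lt.1 hx
      have hz1 : a * |w x| ^ β ≤ a :=
        mul_le_of_le_one_right ha.le (Real.rpow_le_one (abs_nonneg _) hx1 hβ.le)
      -- This fixes the choice of m: m + 1 ≥ p - 1 and β(p - 1) = p, so the remainder of order m + 1
      -- in |w|^β is dominated by |w|^p when |w| ≤ 1.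
      have hmp : p ≤ β * (m + 1 : ℕ) := by
        have h1 : p - 2 ≤ m := Nat.le_ceil _
        have h2 : β * (p - 1) = p := by
          have := hp.symm.sub_one_mul_conj
          linarith
        push_cast
        nlinarith
      have hpow : (|w x| ^ β) ^ (m + 1) ≤ |w x| ^ p := by
        rw [← Real.rpow_natCast, ← Real.rpow_mul (abs_nonneg _)]
        exact Real.rpow_le_rpow_of_exponent_ge' (abs_nonneg _) hx1 hp0.le hmp
      rw [← ofReal_norm, Real.norm_eq_abs,
        ENNReal.ofReal_rpow_of_nonneg (abs_nonneg _) hp0.le, ← ENNReal.ofReal_mul (by positivity)]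
      refine ENNReal.ofReal_le_ofReal ((regExp_le_pow_mul_exp m (by positivity)).trans ?_)
      calc (a * |w x| ^ β) ^ (m + 1) * Real.exp (a * |w x| ^ β)
          ≤ (a * |w x| ^ β) ^ (m + 1) * Real.exp a := by gcongr
        _ = a ^ (m + 1) * Real.exp a * (|w x| ^ β) ^ (m + 1) := by rw [mul_pow]; ring
        _ ≤ _ := by gcongr
    refine (setLIntegral_mono' hEm.compl hpt).trans ((setLIntegral_le_lintegral _ _).trans ?_)
    rw [lintegral_const_mul _ (hw.enorm.pow_const p)]
  rw [← lintegral_add_compl _ hEm, add_mul, add_comm]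
  exact add_le_add (hE3.trans (by gcongr; exact le_self_add)) hE2

end Regularized

end AdamsIneq

namespace AdamsIneq

/-! ### From the rearrangement hypotheses to the kernel bounds -/

section Truncation

/-- The integral of the logarithmic perturbation in the hypothesis on the kernel. -/
noncomputable def logIntegral (γ : ℝ) : ℝ := ∫ u : ℝ, (1 + ‖u‖) ^ (-γ)

/-- The additive constant in the bound of the truncated `L^β` norm of the kernel. -/
noncomputable def truncConst (β γ A H : ℝ) : ℝ :=
  (A ^ (1 / β) * (1 + H)) ^ β / A + (1 + H) ^ β * logIntegral γ

theorem logIntegral_nonneg (γ : ℝ) : 0 ≤ logIntegral γ :=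
  integral_nonneg fun _ => by positivity

theorem truncConst_nonneg {β γ A H : ℝ} (hA : 0 < A) (hH : 0 < H) : 0 ≤ truncConst β γ A H := by
  have := logIntegral_nonneg γ
  unfold truncConst
  positivity

/-- Substituting u = log t turns the perturbation into (1 + |u|)^{-γ}, integrable over all of ℝ
because γ > 1; hence its cost does not depend on r and τ. -/
theorem setLIntegral_inv_mul_log_le {A D γ r τ : ℝ} (hA : 0 ≤ A) (hD : 0 ≤ D) (hγ : 1 < γ)
    (hr : 0 < r) (hrτ : r ≤ τ) :
    ∫⁻ t in Ioc r τ, ENNReal.ofReal (A * t⁻¹ * (1 + D * (1 + |Real.log t|) ^ (-γ))) ≤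
      ENNReal.ofReal (A * (Real.log (τ / r) + D * logIntegral γ)) := by
  have hτ : 0 < τ := hr.trans_le hrτ
  set h : ℝ → ℝ≥0∞ := fun u => ENNReal.ofReal (A * (1 + D * (1 + |u|) ^ (-γ))) with hh
  have hint : Integrable fun u : ℝ => (1 + ‖u‖) ^ (-γ) :=
    integrable_one_add_norm (by simpa using hγ)
  have e1 : ∫⁻ t in Ioc r τ, ENNReal.ofReal (A * t⁻¹ * (1 + D * (1 + |Real.log t|) ^ (-γ))) =
      ∫⁻ u in Real.log '' Ioc r τ, h u := by
    rw [lintegral_image_eq_lintegral_abs_deriv_mul measurableSet_Ioc (f' := fun t => t⁻¹)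
      (fun t ht => (Real.hasDerivAt_log (hr.trans ht.1).ne').hasDerivWithinAt)
      (fun s hs t ht hst => Real.log_injOn_pos (hr.trans hs.1) (hr.trans ht.1) hst)]
    refine setLIntegral_congr_fun measurableSet_Ioc fun t ht => ?_
    have ht0 : 0 < t := hr.trans ht.1
    simp only [hh]
    rw [← ENNReal.ofReal_mul (abs_nonneg _), abs_of_pos (inv_pos.2 ht0)]
    congr 1
    ring
  have hsub : Real.log '' Ioc r τ ⊆ Ioc (Real.log r) (Real.log τ) := by
    rintro _ ⟨t, ht, rfl⟩
    exact ⟨Real.log_lt_log hr ht.1, Real.log_le_log (hr.trans ht.1) ht.2⟩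
  have hlog : 0 ≤ Real.log (τ / r) := Real.log_nonneg ((one_le_div hr).2 hrτ)
  have e2 : ∀ u, h u = ENNReal.ofReal A + ENNReal.ofReal (A * D * (1 + ‖u‖) ^ (-γ)) := fun u => by
    rw [← ENNReal.ofReal_add hA (by positivity)]
    simp only [hh, Real.norm_eq_abs]
    congr 1
    ring
  rw [e1]
  calc ∫⁻ u in Real.log '' Ioc r τ, h u
      ≤ ∫⁻ u in Ioc (Real.log r) (Real.log τ), h u := lintegral_mono_set hsub
    _ = ENNReal.ofReal A * ENNReal.ofReal (Real.log (τ / r)) +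
        ∫⁻ u in Ioc (Real.log r) (Real.log τ), ENNReal.ofReal (A * D * (1 + ‖u‖) ^ (-γ)) := by
        simp_rw [e2]
        rw [lintegral_add_left measurable_const, setLIntegral_const, Real.volume_Ioc,
          Real.log_div hτ.ne' hr.ne']
    _ ≤ ENNReal.ofReal A * ENNReal.ofReal (Real.log (τ / r)) +
        ∫⁻ u : ℝ, ENNReal.ofReal (A * D * (1 + ‖u‖) ^ (-γ)) :=
        add_le_add_right (setLIntegral_le_lintegral _ _) _
    _ = _ := by
        have hI := logIntegral_nonneg γ
        rw [← ofReal_integral_eq_lintegral_ofReal (hint.const_mul _)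
          (Filter.Eventually.of_forall fun u => by positivity), integral_const_mul,
          ← ENNReal.ofReal_mul hA, ← logIntegral,
          ← ENNReal.ofReal_add (by positivity) (by positivity)]
        congr 1
        ring

/-- Convexity of x^β: the chord from 1 to 1 + H lies above the graph. -/
theorem one_add_mul_rpow_le {β H s : ℝ} (hβ : 1 ≤ β) (hH : 0 ≤ H) (hs : 0 ≤ s) (hs1 : s ≤ 1) :
    (1 + H * s) ^ β ≤ 1 + (1 + H) ^ β * s := by
  have h := (convexOn_rpow hβ).2 (show (1 : ℝ) ∈ Ici 0 from mem_Ici.2 zero_le_one)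
    (show 1 + H ∈ Ici (0 : ℝ) from by simp only [mem_Ici]; linarith)
    (by linarith : 0 ≤ 1 - s) hs (by ring)
  simp only [smul_eq_mul, Real.one_rpow, mul_one] at h
  have e : 1 - s + s * (1 + H) = 1 + H * s := by ring
  rw [e] at h
  linarith

variable {M : Type*} [MeasurableSpace M] {μ : Measure M} {u : M → ℝ≥0∞}

theorem keep_Iic_le_min (s z : ℝ≥0∞) : keep (Iic s) z ≤ min z s :=
  le_min (keep_le_self _ _) (keep_Iic_le _ _)

/-- Pass to the rearrangement capped at the truncation level. On (0, r] the cap gives the constant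
c^β, on (r, τ] the sharp hypothesis gives A log(τ/r) + O(1), and beyond τ the integral is at most
AJ. -/
theorem lintegral_trunc_rpow_le {β γ A H J τ : ℝ} (hβ : 1 < β) (hγ : 1 < γ) (hA : 0 < A)
    (hH : 0 < H) (hJ : 0 ≤ J) (hu : Measurable u)
    (hb : ∀ t, 0 < t → t ≤ τ → rearrangement μ u t ≤
      ENNReal.ofReal (A ^ (1 / β) * t ^ (-(1 / β)) * (1 + H * (1 + |Real.log t|) ^ (-γ))))
    (hJb : ∫⁻ t in Ioi τ, rearrangement μ u t ^ β ≤ ENNReal.ofReal (A * J)) {r : ℝ} (hr : 0 < r)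
    (hrτ : r ≤ τ) :
    ∫⁻ y, keep (Iic (cut β (A ^ (1 / β) * (1 + H)) r)) (u y) ^ β ∂μ ≤
      ENNReal.ofReal (A * (Real.log (τ / r) + J + truncConst β γ A H)) := by
  have hβ0 : 0 < β := by linarith
  set c := A ^ (1 / β) * (1 + H) with hc
  have hc0 : 0 < c := by positivity
  set s := cut β c r with hs
  set R := rearrangement μ u with hR
  have hsplit : Ioi (0 : ℝ) = Ioc 0 r ∪ (Ioc r τ ∪ Ioi τ) := by
    rw [Ioc_union_Ioi_eq_Ioi hrτ, Ioc_union_Ioi_eq_Ioi hr.le]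
  have b1 : ∫⁻ t in Ioc 0 r, min (R t) s ^ β ≤ ENNReal.ofReal (c ^ β) := by
    calc ∫⁻ t in Ioc 0 r, min (R t) s ^ β ≤ ∫⁻ _ in Ioc 0 r, s ^ β :=
          lintegral_mono fun t => ENNReal.rpow_le_rpow (min_le_right _ _) hβ0.le
      _ = s ^ β * ENNReal.ofReal r := by rw [setLIntegral_const, Real.volume_Ioc, sub_zero]
      _ = _ := cut_rpow_mul hβ0 hc0 hr
  have b2 : ∫⁻ t in Ioc r τ, min (R t) s ^ β ≤
      ENNReal.ofReal (A * (Real.log (τ / r) + (1 + H) ^ β * logIntegral γ)) := by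
    refine le_trans (setLIntegral_mono' measurableSet_Ioc fun t ht => ?_)
      (setLIntegral_inv_mul_log_le hA.le (by positivity) hγ hr hrτ)
    have ht0 : 0 < t := hr.trans ht.1
    have hψ0 : 0 ≤ (1 + |Real.log t|) ^ (-γ) := by positivity
    have hψ1 : (1 + |Real.log t|) ^ (-γ) ≤ 1 :=
      Real.rpow_le_one_of_one_le_of_nonpos (by linarith [abs_nonneg (Real.log t)]) (by linarith)
    refine (ENNReal.rpow_le_rpow ((min_le_left _ _).trans (hb t ht0 ht.2)) hβ0.le).trans ?_
    rw [ENNReal.ofReal_rpow_of_nonneg (by positivity) hβ0.le]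
    refine ENNReal.ofReal_le_ofReal ?_
    have e : (t ^ (-(1 / β))) ^ β = t⁻¹ := by
      rw [← Real.rpow_mul ht0.le, neg_mul, one_div_mul_cancel hβ0.ne', Real.rpow_neg_one]
    rw [Real.mul_rpow (by positivity) (by positivity), Real.mul_rpow (by positivity) (by positivity),
      rpow_one_div_rpow hA.le hβ0, e]
    exact mul_le_mul_of_nonneg_left (one_add_mul_rpow_le hβ.le hH.le hψ0 hψ1) (by positivity)
  have b3 : ∫⁻ t in Ioi τ, min (R t) s ^ β ≤ ENNReal.ofReal (A * J) :=
    (lintegral_mono fun t => ENNReal.rpow_le_rpow (min_le_left _ _) hβ0.le).trans hJb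
  have hlog : 0 ≤ Real.log (τ / r) := Real.log_nonneg ((one_le_div hr).2 hrτ)
  have hI := logIntegral_nonneg γ
  calc ∫⁻ y, keep (Iic s) (u y) ^ β ∂μ ≤ ∫⁻ y, min (u y) s ^ β ∂μ :=
        lintegral_mono fun y => ENNReal.rpow_le_rpow (keep_Iic_le_min _ _) hβ0.le
    _ ≤ ∫⁻ t in Ioi (0 : ℝ), min (R t) s ^ β :=
        lintegral_min_rpow_le_rearrangement hu hβ0 cut_ne_top
    _ ≤ ENNReal.ofReal (c ^ β) + (ENNReal.ofReal
          (A * (Real.log (τ / r) + (1 + H) ^ β * logIntegral γ)) + ENNReal.ofReal (A * J)) := by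
        rw [hsplit]
        exact (lintegral_union_le _ _ _).trans (add_le_add b1
          ((lintegral_union_le _ _ _).trans (add_le_add b2 b3)))
    _ = _ := by
        rw [← ENNReal.ofReal_add (by positivity) (by positivity),
          ← ENNReal.ofReal_add (by positivity) (by positivity)]
        congr 1
        rw [truncConst, ← hc]
        field_simp
        ring

end Truncation

variable {M N : Type*} [MeasurableSpace M] [MeasurableSpace N] {μ : Measure M} {ν : Measure N}

theorem measurable_ereal_abs : Measurable EReal.abs :=
  EReal.measurable_of_measurable_real (by simpa [EReal.abs_def] using measurable_id.abs.ennreal_ofReal)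

theorem enorm_toReal_le_abs (z : EReal) : ‖z.toReal‖ₑ ≤ z.abs := by
  induction z with
  | bot => simp
  | coe r => rw [EReal.toReal_coe, EReal.abs_def, ← ofReal_norm, Real.norm_eq_abs]
  | top => simp

/-- The hypotheses on the maximal rearrangements, together with measurability of the kernel, give
the quantitative bounds for a measurable modification of its absolute value. -/
theorem exists_kernelBounds [SFinite μ] [SFinite ν] {k : N → M → EReal} {β σ γ A B H τ : ℝ}
    (hβ : 1 < β) (hσ : 0 < σ) (hγ : 1 < γ) (hA : 0 < A) (hB : 0 < B) (hH : 0 < H)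
    {k' : N × M → EReal} (hk' : Measurable k') (hkk' : Function.uncurry k =ᵐ[ν.prod μ] k')
    (h1 : ∀ t : ℝ, 0 < t → t ≤ τ → maxRearr₁ μ ν k t ≤
      ENNReal.ofReal (A ^ (1 / β) * t ^ (-(1 / β)) * (1 + H * (1 + |Real.log t|) ^ (-γ))))
    (h2 : ∀ t : ℝ, 0 < t → maxRearr₂ μ ν k t ≤ ENNReal.ofReal (B * t ^ (-(1 / (σ * β)))))
    (hJ : critJ μ ν k A β τ < ∞) :
    KernelBounds μ ν (fun x y => (k' (x, y)).abs) β σ A B (A ^ (1 / β) * (1 + H))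
      (truncConst β γ A H) (critJ μ ν k A β τ).toReal τ := by
  have hβ0 : 0 < β := by linarith
  set J := (critJ μ ν k A β τ).toReal with hJd
  have hm : Measurable (Function.uncurry fun x y => (k' (x, y)).abs) :=
    measurable_ereal_abs.comp hk'
  have hJ0 : 0 ≤ J := ENNReal.toReal_nonneg
  -- Changing k on a product null set alters almost every section only on a null set, which
  -- rearrangements ignore.
  have hx1 : ∀ᵐ x ∂ν, partialRearr₁ μ k x = rearrangement μ fun y => (k' (x, y)).abs := by
    filter_upwards [Measure.ae_ae_of_ae_prod hkk'] with x hx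
    exact rearrangement_congr (hx.mono fun y (hy : k x y = k' (x, y)) => by
      change (k x y).abs = _; rw [hy])
  have hy1 : ∀ᵐ y ∂μ, partialRearr₂ ν k y = rearrangement ν fun x => (k' (x, y)).abs := by
    have hsw : ∀ᵐ z ∂μ.prod ν, Function.uncurry k z.swap = k' z.swap :=
      Measure.measurePreserving_swap.quasiMeasurePreserving.ae hkk'
    filter_upwards [Measure.ae_ae_of_ae_prod hsw] with y hy
    exact rearrangement_congr (hy.mono fun x (hx : k x y = k' (x, y)) => by
      change (k x y).abs = _; rw [hx])
  have hx2 := ae_forall_le_of_essSup_le (ν := ν) (R := partialRearr₁ μ k)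
    (fun x => rearrangement_antitone _ _) (τ := τ) (φ := fun t =>
      ENNReal.ofReal (A ^ (1 / β) * t ^ (-(1 / β)) * (1 + H * (1 + |Real.log t|) ^ (-γ))))
    (fun t ht => by
      refine ENNReal.continuous_ofReal.continuousAt.comp ?_
      refine (continuousAt_const.mul (Real.continuousAt_rpow_const _ _ (Or.inl ht.ne'))).mul
        (continuousAt_const.add (continuousAt_const.mul (ContinuousAt.rpow_const
          (continuousAt_const.add (Real.continuousAt_log ht.ne').abs) (Or.inl ?_))))
      positivity) h1
  have hx3 : ∀ᵐ x ∂ν, ∫⁻ t in Ioi τ, partialRearr₁ μ k x t ^ β ≤ ENNReal.ofReal (A * J) := by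
    filter_upwards [ENNReal.ae_le_essSup (μ := ν)
      fun x => ∫⁻ t in Ioi τ, partialRearr₁ μ k x t ^ β] with x hx
    refine hx.trans (le_of_eq ?_)
    rw [ENNReal.ofReal_mul hA.le, hJd, ENNReal.ofReal_toReal hJ.ne, critJ, ← mul_assoc,
      ENNReal.mul_inv_cancel (by simpa using hA) ENNReal.ofReal_ne_top, one_mul]
  -- Countably many bounded ranges (0, n] exhaust all t > 0.
  have hy2 : ∀ᵐ y ∂μ, ∀ n : ℕ, ∀ t : ℝ, 0 < t → t ≤ n → partialRearr₂ ν k y t ≤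
      ENNReal.ofReal (B * t ^ (-(1 / (σ * β)))) := by
    rw [ae_all_iff]
    exact fun n => ae_forall_le_of_essSup_le (fun y => rearrangement_antitone _ _)
      (fun t ht => ENNReal.continuous_ofReal.continuousAt.comp (continuousAt_const.mul
        (Real.continuousAt_rpow_const _ _ (Or.inl ht.ne')))) fun t ht _ => h2 t ht
  refine ⟨hm, ?_, ?_, ?_⟩
  · filter_upwards [hx1, hx2] with x hx hb r hr hrτ
    refine measure_lt_le_of_rearrangement_le ?_
    rw [← hx]
    refine (hb r hr hrτ).trans (ENNReal.ofReal_le_ofReal ?_)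
    have hψ1 : (1 + |Real.log r|) ^ (-γ) ≤ 1 :=
      Real.rpow_le_one_of_one_le_of_nonpos (by linarith [abs_nonneg (Real.log r)]) (by linarith)
    calc _ ≤ A ^ (1 / β) * r ^ (-(1 / β)) * (1 + H * 1) := by gcongr
      _ = _ := by ring
  · filter_upwards [hx1, hx2, hx3] with x hx hb hJb r hr hrτ
    simp only [hx] at hb hJb
    exact lintegral_trunc_rpow_le hβ hγ hA hH hJ0 (hm.comp measurable_prodMk_left) hb hJb hr hrτ
  · filter_upwards [hy1, hy2] with y hy hb v hv
    refine measure_lt_le_of_rearrangement_le ?_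
    rw [← hy]
    -- This t solves B t^{-1/(σβ)} = v.
    have ht : 0 < (B / v) ^ (σ * β) := by positivity
    obtain ⟨n, hn⟩ := exists_nat_ge ((B / v) ^ (σ * β))
    refine (hb n _ ht hn).trans (le_of_eq ?_)
    congr 1
    rw [← Real.rpow_mul (by positivity)]
    have : σ * β * -(1 / (σ * β)) = -1 := by field_simp
    rw [this, Real.rpow_neg_one]
    field_simp

/-- The constant of the Adams inequality. -/
noncomputable def fullConst (β σ γ A B H : ℝ) : ℝ :=
  adamsConst β (Real.conjExponent β) σ A B (A ^ (1 / β) * (1 + H)) (truncConst β γ A H) +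
    (σ / A) ^ (⌈Real.conjExponent β - 2⌉₊ + 1) * Real.exp (σ / A)

end AdamsIneq

/-! ### Assembly for signed kernels and densities -/

theorem theorem1 (β σ γ A B H : ℝ) (hβ : 1 < β) (hσ : 0 < σ) (hσ1 : σ ≤ 1) (hγ : 1 < γ)
    (hA : 0 < A) (hB : 0 < B) (hH : 0 < H) :
    ∃ C : ℝ, 0 < C ∧
      ∀ (M N : Type*) [MeasurableSpace M] [MeasurableSpace N]
        (μ : Measure M) (ν : Measure N) [SFinite μ] [SFinite ν]
        (k : N → M → EReal) (τ : ℝ),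
        AEMeasurable (Function.uncurry k) (ν.prod μ) →
        0 < τ →
        (∀ t : ℝ, 0 < t → t ≤ τ →
          AdamsIneq.maxRearr₁ μ ν k t ≤
            ENNReal.ofReal (A ^ (1 / β) * t ^ (-(1 / β)) *
              (1 + H * (1 + |Real.log t|) ^ (-γ)))) →
        (∀ t : ℝ, 0 < t →
          AdamsIneq.maxRearr₂ μ ν k t ≤ ENNReal.ofReal (B * t ^ (-(1 / (σ * β))))) →
        AdamsIneq.critJ μ ν k A β τ < ∞ →
        -- `Tf` is well defined, finite almost everywhere, and measurable
        (∀ f : M → ℝ, MemLp f (ENNReal.ofReal (Real.conjExponent β)) μ →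
          (∀ᵐ x ∂ν, AdamsIneq.PotentialFinite μ k f x) ∧
          AEStronglyMeasurable (AdamsIneq.potential μ k f) ν) ∧
        (∀ f : M → ℝ, MemLp f (ENNReal.ofReal (Real.conjExponent β)) μ →
          eLpNorm f (ENNReal.ofReal (Real.conjExponent β)) μ ≤ 1 →
          -- the inequality on sets of finite measure
          (∀ E : Set N, MeasurableSet E → ν E < ∞ →
            ∫⁻ x in E, ENNReal.ofReal
                (Real.exp (σ / A * |AdamsIneq.potential μ k f x| ^ β)) ∂ν ≤
              ENNReal.ofReal (C * Real.exp (σ * (AdamsIneq.critJ μ ν k A β τ).toReal)) *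
                (ν E + ENNReal.ofReal
                  (τ ^ σ * (1 + (AdamsIneq.critJ μ ν k A β τ).toReal)))) ∧
          -- the regularized inequality on the whole space
          ∫⁻ x, ENNReal.ofReal (AdamsIneq.regExp ⌈Real.conjExponent β - 2⌉₊
                (σ / A * |AdamsIneq.potential μ k f x| ^ β)) ∂ν ≤
            ENNReal.ofReal (C * Real.exp (σ * (AdamsIneq.critJ μ ν k A β τ).toReal)) *
              (eLpNorm (AdamsIneq.potential μ k f)
                  (ENNReal.ofReal (Real.conjExponent β)) ν ^ Real.conjExponent β +
                ENNReal.ofReal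
                  (τ ^ σ * (1 + (AdamsIneq.critJ μ ν k A β τ).toReal)))) := by
  have hp : β.HolderConjugate (Real.conjExponent β) := Real.HolderConjugate.conjExponent hβ
  have hβ0 := hp.pos
  set p := Real.conjExponent β with hpd
  have hp0 := hp.symm.pos
  set c := A ^ (1 / β) * (1 + H) with hc
  have hc0 : 0 < c := by positivity
  set K := AdamsIneq.truncConst β γ A H with hK
  have hK0 : 0 ≤ K := AdamsIneq.truncConst_nonneg hA hH
  set Ca := AdamsIneq.adamsConst β p σ A B c K with hCa
  have hCa0 : 0 < Ca := AdamsIneq.adamsConst_pos hp hσ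
  set Cb := (σ / A) ^ (⌈p - 2⌉₊ + 1) * Real.exp (σ / A) with hCb
  have hCb0 : 0 < Cb := by positivity
  have hC : AdamsIneq.fullConst β σ γ A B H = Ca + Cb := rfl
  refine ⟨AdamsIneq.fullConst β σ γ A B H, by rw [hC]; positivity, ?_⟩
  intro M N _ _ μ ν _ _ k τ hk hτ h1 h2 hJ
  rw [hC]
  set k' := hk.mk _ with hk'
  have hk'm : Measurable k' := hk.measurable_mk
  have hG := AdamsIneq.exists_kernelBounds hβ hσ hγ hA hB hH hk'm hk.ae_eq_mk h1 h2 hJ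
  set J := (AdamsIneq.critJ μ ν k A β τ).toReal with hJd
  have hJ0 : 0 ≤ J := ENNReal.toReal_nonneg
  have hkx : ∀ᵐ x ∂ν, ∀ᵐ y ∂μ, k x y = k' (x, y) := Measure.ae_ae_of_ae_prod hk.ae_eq_mk
  -- Measurable representatives: g for |f| and w for Tf, with |w| dominated everywhere by the
  -- potential of g under |k'|.
  have key : ∀ f : M → ℝ, MemLp f (ENNReal.ofReal p) μ → ∃ (g : M → ℝ≥0∞) (w : N → ℝ),
      Measurable g ∧ Measurable w ∧ ∫⁻ y, g y ^ p ∂μ = eLpNorm f (ENNReal.ofReal p) μ ^ p ∧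
      AdamsIneq.potential μ k f =ᵐ[ν] w ∧
      (∀ x, ‖w x‖ₑ ≤ ∫⁻ y, (k' (x, y)).abs * g y ∂μ) ∧
      ∀ᵐ x ∂ν, AEMeasurable (fun y => k x y * (f y : EReal)) μ ∧
        ∫⁻ y, (k x y * (f y : EReal)).abs ∂μ = ∫⁻ y, (k' (x, y)).abs * g y ∂μ := by
    intro f hf
    set f' := hf.1.mk f with hf'
    have hf'm : Measurable f' := hf.1.stronglyMeasurable_mk.measurable
    have hff' : f =ᵐ[μ] f' := hf.1.ae_eq_mk
    have hzm : Measurable fun z : N × M => k' z * (f' z.2 : EReal) :=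
      hk'm.mul (hf'm.comp measurable_snd).coe_real_ereal
    have hcongr : ∀ᵐ x ∂ν, (fun y => k x y * (f y : EReal)) =ᵐ[μ]
        fun y => k' (x, y) * (f' y : EReal) := by
      filter_upwards [hkx] with x hx
      filter_upwards [hx, hff'] with y hy hy'
      rw [hy, hy']
    have habs : ∀ x y, (k' (x, y) * (f' y : EReal)).abs = (k' (x, y)).abs * ‖f' y‖ₑ := by
      intro x y
      rw [EReal.abs_mul, EReal.abs_def, ← ofReal_norm, Real.norm_eq_abs]
    refine ⟨fun y => ‖f' y‖ₑ, fun x => ∫ y, (k' (x, y) * (f' y : EReal)).toReal ∂μ, hf'm.enorm, ?_,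
      ?_, ?_, ?_, ?_⟩
    · exact (hzm.ereal_toReal.stronglyMeasurable.integral_prod_right').measurable
    · rw [eLpNorm_congr_ae hff', AdamsIneq.eLpNorm_ofReal_rpow hp0]
    · filter_upwards [hcongr] with x hx
      exact integral_congr_ae (hx.mono fun y hy => congrArg EReal.toReal hy)
    · intro x
      refine (enorm_integral_le_lintegral_enorm _).trans (lintegral_mono fun y => ?_)
      exact (AdamsIneq.enorm_toReal_le_abs _).trans (habs x y).le
    · filter_upwards [hcongr] with x hx
      refine ⟨(hzm.comp measurable_prodMk_left).aemeasurable.congr hx.symm, ?_⟩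
      refine lintegral_congr_ae (hx.mono fun y hy => ?_)
      exact (congrArg EReal.abs hy).trans (habs x y)
  constructor
  · intro f hf
    obtain ⟨g, w, hg, hw, hgf, hfw, -, hae⟩ := key f hf
    refine ⟨?_, hw.aestronglyMeasurable.congr hfw.symm⟩
    have hgt : ∫⁻ y, g y ^ p ∂μ ≠ ∞ := by
      rw [hgf]
      exact ENNReal.rpow_ne_top_of_nonneg hp0.le hf.2.ne
    filter_upwards [hae, hG.ae_lintegral_lt_top hp hσ hB hc0 hτ hg hgt] with x hx hx'
    exact ⟨hx.1, hx.2 ▸ hx'⟩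
  · intro f hf hf1
    obtain ⟨g, w, hg, hw, hgf, hfw, hwg, -⟩ := key f hf
    have hg1 : ∫⁻ y, g y ^ p ∂μ ≤ 1 := by
      rw [hgf]
      exact ENNReal.rpow_le_one hf1 hp0.le
    have hlt := hG.ae_lintegral_lt_top hp hσ hB hc0 hτ hg (hg1.trans_lt ENNReal.one_lt_top).ne
    -- The argument yields τ^σ alone; the factor 1 + J is slack.
    have hτJ : ENNReal.ofReal (τ ^ σ) ≤ ENNReal.ofReal (τ ^ σ * (1 + J)) :=
      ENNReal.ofReal_le_ofReal (le_mul_of_one_le_right (by positivity) (by linarith))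
    have hE : ∀ E : Set N, MeasurableSet E → ν E < ∞ →
        ∫⁻ x in E, ENNReal.ofReal (Real.exp (σ / A * |w x| ^ β)) ∂ν ≤
          ENNReal.ofReal (Ca * Real.exp (σ * J)) *
            (ν E + ENNReal.ofReal (τ ^ σ * (1 + J))) := by
      intro E hEm hEt
      refine le_trans (lintegral_mono_ae (ae_restrict_of_ae ?_))
        ((hG.setLIntegral_exp_le hp hσ hA hB hc0 hK0 hJ0 hτ hg hg1 hEm hEt.ne).trans
          (mul_le_mul_right (add_le_add_right hτJ _) _))
      filter_upwards [hlt] with x hx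
      refine ENNReal.ofReal_le_ofReal (Real.exp_le_exp.2 (mul_le_mul_of_nonneg_left
        (Real.rpow_le_rpow (abs_nonneg _) ?_ hβ0.le) (by positivity)))
      rw [← ENNReal.ofReal_le_iff_le_toReal hx.ne, ← Real.norm_eq_abs, ofReal_norm]
      exact hwg x
    constructor
    · intro E hEm hEt
      refine le_trans (le_of_eq (lintegral_congr_ae (ae_restrict_of_ae (hfw.mono fun x hx => ?_))))
        ((hE E hEm hEt).trans (mul_le_mul_left (ENNReal.ofReal_le_ofReal ?_) _))
      · simp only [hx]
      · exact mul_le_mul_of_nonneg_right (by linarith) (Real.exp_pos _).le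
    · rw [eLpNorm_congr_ae hfw]
      refine le_trans (le_of_eq (lintegral_congr_ae (hfw.mono fun x hx => ?_)))
        ((AdamsIneq.lintegral_regExp_le hp (by positivity) hw ?_ hE).trans
          (mul_le_mul_left ?_ _))
      · simp only [hx]
      · have : 0 < Ca * Real.exp (σ * J) := by positivity
        simpa using this
      · rw [← hCb, ← ENNReal.ofReal_add hCb0.le (by positivity)]
        refine ENNReal.ofReal_le_ofReal ?_
        have : 1 ≤ Real.exp (σ * J) := Real.one_le_exp (by positivity)
        nlinarith
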